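/- \textbf{Theorem.} Let $M$ be a loopless matroid of rank $d+1$ ($d\ge 0$) on a finite set $E$, let $V=\mathbb{R}^E/\mathbb{R}(1,\dots,1)$, and for $F\subseteq E$ let $u_F\in V$ be the class of the indicator vector of $F$. The Bergman fan $\Sigma_M$ of $M$ consists of the cones generated by $u_{F_1},\dots,u_{F_k}$ for all flags $\emptyset\subsetneq F_1\subsetneq\cdots\subsetneq F_k\subsetneq E$ of flats of $M$ ($k\ge 0$), with marking $u=(u_F)_F$ and weight $\omega(\sigma)=1$ for every $d$-dimensional cone $\sigma$. Then $(\Sigma_M,u,\omega)$ is a marked tropical $d$-fan, and it is Lorentzian. The same holds for every equivalent pair of a marking and a weight, that is, with $u_F$ replaced by $c_Fu_F$ and $\omega(\sigma)$ replaced by $\omega(\sigma)\prod_{\rho_F\in\sigma(1)}c_F^{-1}$ for any positive real numbers $c_F$, where $\rho_F$ is the ray of $u_F$; thus the tropical fan $(\Sigma_M,\omega)$ is Lorentzian. Here the following definitions are used. Let $\Sigma$ be a simplicial fan in a finite-dimensional real vector space $V$, all of whose inclusion-maximal cones have dimension $d$ (a simplicial $d$-fan). Write $\Sigma(k)$ for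 the set of its $k$-dimensional cones, $V_\tau$ for the span of a cone $\tau$, and $\tau(1)$ for the set of rays of $\tau$. A marking $u$ is a choice of a nonzero vector $u_\rho$ on each ray $\rho\in\Sigma(1)$. A Minkowski $k$-weight on $(\Sigma,u)$ is a function $\omega:\Sigma(k)\to\mathbb{R}$ such that $\sum_{\sigma\in\Sigma(k),\,\sigma\succ\tau}\omega(\sigma)u_{\sigma\setminus\tau}\in V_\tau$ for every $\tau\in\Sigma(k-1)$, where $\sigma\setminus\tau$ is the ray of $\sigma$ not in $\tau$. A marked tropical $d$-fan is a triple $(\Sigma,u,\omega)$ in which $\Sigma$ is a simplicial $d$-fan, $u$ is a marking of it, and $\omega$ is a Minkowski $d$-weight with positive values. A divisor on $\Sigma$ is an element of $D(\Sigma)=PL(\Sigma)/L(\Sigma)$, the space of continuous functions on the support of $\Sigma$ that are linear on each cone, modulo restrictions of linear functions on $V$. A divisor $D$, represented by $\phi$ with $\phi|_\sigma=\phi_\sigma\in V^\vee$, acts on a Minkowski $k$-weight $\omega$ and gives the Minkowski $(k-1)$-weight $$(D\cdot\omega)(\tau)=\sum_{\sigma\in\Sigma(k),\,\sigma\succ\tau}\phi_\sigma\big(\omega(\sigma)u_{\sigma\setminus\tau}\big)-\phi_\tau\Big(\sum_{\sigma\in\Sigma(k),\,\sigma\succ\tau}\omega(\sigma)u_{\sigma\setminus\tau}\Big),$$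 and the mixed degree of $D_1,\dots,D_d$ is $\deg_{\Sigma,u,\omega}(D_1\cdots D_d)=(D_1\cdots D_d\cdot\omega)(0)$. A divisor $D$ is strictly convex if for every $\tau\in\Sigma$ it has a representative that vanishes on $\tau$ and is strictly positive on $\sigma\setminus\tau$ (set difference) for every $\sigma\in\Sigma$ having $\tau$ as a face. Let $K(\Sigma)$ be the set of strictly convex divisors. For $\tau\in\Sigma$ the star $\Sigma^\tau$ is the fan in $V/V_\tau$ consisting of the images of all faces of the cones of $\Sigma$ that have $\tau$ as a face. Its dimension is $d^\tau=d-\dim\tau$; it is marked by the images of the corresponding marks $u_\rho$, and its weight is $\omega^\tau(\bar\sigma)=\omega(\sigma)$, for $\sigma\in\Sigma(d)$ containing $\tau$. The marked tropical $d$-fan $(\Sigma,u,\omega)$ is Lorentzian if $K(\Sigma)\ne\emptyset$ and, for every $\tau\in\Sigma$ with $d^\tau\ge 2$ and all $D_3,\dots,D_{d^\tau}\in K(\Sigma^\tau)$, the symmetric bilinear form $(D_1,D_2)\mapsto\deg_{\Sigma^\tau,u^\tau,\omega^\tau}(D_1D_2D_3\cdots D_{d^\tau})$ on $D(\Sigma^\tau)$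 has exactly one positive eigenvalue (counted with multiplicity). -/

import Mathlib

/-! # Marked simplicial fans

A marked simplicial fan in a real vector space `V` is recorded by its marked rays and by the sets of
rays that span its cones (just as `Geometry.SimplicialComplex` records a simplicial complex by the
vertex sets of its simplices): `mark ρ` is the marking vector `u_ρ`, and a finite set `σ` of rays in
`faces` stands for the cone generated by the vectors `u_ρ`, `ρ ∈ σ`. -/

/-- The data of a finite family of cones with marked generators. Such a family is a marked
simplicial fan when it satisfies `MarkedCones.IsSimplicialFan`. -/
structure MarkedCones (ι V : Type*) where
  /-- the ray sets `σ(1)` of the cones `σ` -/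
  faces : Finset (Finset ι)
  /-- the marking `u` -/
  mark : ι → V

namespace MarkedCones

variable {ι V : Type*} [DecidableEq ι] [AddCommGroup V] [Module ℝ V]

/-- The cone of all nonnegative combinations of the marks of the rays in `σ`. -/
def cone (X : MarkedCones ι V) (σ : Finset ι) : PointedCone ℝ V :=
  PointedCone.hull ℝ (X.mark '' (σ : Set ι))

/-- The linear span `V_σ` of the cone of `σ`. -/
def coneSpan (X : MarkedCones ι V) (σ : Finset ι) : Submodule ℝ V :=
  Submodule.span ℝ (X.mark '' (σ : Set ι))

/-- The support: the union of all the cones. -/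
def support (X : MarkedCones ι V) : Set V :=
  {x | ∃ σ ∈ X.faces, x ∈ X.cone σ}

/-- `X` is a marked simplicial `d`-fan. Since the cones are generated by linearly independent
vectors, they are strongly convex and polyhedral, `cone σ` has dimension `#σ`, and its faces are the
cones of the subsets of `σ`; so `down_closed` and `inter` are the two axioms of a fan. -/
structure IsSimplicialFan (X : MarkedCones ι V) (d : ℕ) : Prop where
  empty_mem : ∅ ∈ X.faces
  indep : ∀ σ ∈ X.faces, LinearIndepOn ℝ X.mark (σ : Set ι)
  down_closed : ∀ σ ∈ X.faces, ∀ τ ⊆ σ, τ ∈ X.faces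
  inter : ∀ σ ∈ X.faces, ∀ τ ∈ X.faces, ∀ x, x ∈ X.cone σ → x ∈ X.cone τ → x ∈ X.cone (σ ∩ τ)
  pure : ∀ σ, Maximal (· ∈ X.faces) σ → σ.card = d

/-- The rays `ρ` not in `τ` that span, together with `τ`, a cone of `X`. Then `σ = insert ρ τ` runs
through the cones of dimension `dim τ + 1` that contain `τ` as a face, and `ρ = σ \ τ`. -/
def link (X : MarkedCones ι V) (τ : Finset ι) : Finset ι :=
  (X.faces.biUnion id).filter (fun ρ => ρ ∉ τ ∧ insert ρ τ ∈ X.faces)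

/-! ## Minkowski weights

A `k`-weight is a function on the `k`-dimensional cones. We let a weight be a function on all finite
sets of rays; only its values on the cones of the relevant dimension matter. -/

/-- The values of `ω` on the `k`-dimensional cones form a Minkowski `k`-weight: they satisfy the
balancing condition at each cone of dimension `k - 1`. -/
def IsMinkowskiWeight (X : MarkedCones ι V) (k : ℕ) (ω : Finset ι → ℝ) : Prop :=
  ∀ τ ∈ X.faces, τ.card + 1 = k →
    ∑ ρ ∈ X.link τ, ω (insert ρ τ) • X.mark ρ ∈ X.coneSpan τ

/-- `(X, ω)` is a marked tropical `d`-fan: a marked simplicial `d`-fan with a positive Minkowski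
`d`-weight. -/
structure IsTropical (X : MarkedCones ι V) (d : ℕ) (ω : Finset ι → ℝ) : Prop where
  fan : X.IsSimplicialFan d
  balanced : X.IsMinkowskiWeight d ω
  pos : ∀ σ ∈ X.faces, σ.card = d → 0 < ω σ

/-! ## Piecewise linear functions and divisors -/

/-- The space `PL(X)` of piecewise linear functions on the support of `X`. (Such a function is
linear on each of finitely many closed cones, hence continuous.) -/
def PL (X : MarkedCones ι V) : Submodule ℝ (X.support → ℝ) where
  carrier := {φ | ∀ σ ∈ X.faces, ∃ l : V →ₗ[ℝ] ℝ, ∀ x : X.support, (x : V) ∈ X.cone σ → φ x = l x}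
  zero_mem' := fun _ _ => ⟨0, by simp⟩
  add_mem' := by
    intro φ ψ hφ hψ σ hσ
    obtain ⟨l, hl⟩ := hφ σ hσ
    obtain ⟨m, hm⟩ := hψ σ hσ
    exact ⟨l + m, fun x hx => by simp [hl x hx, hm x hx]⟩
  smul_mem' := by
    intro c φ hφ σ hσ
    obtain ⟨l, hl⟩ := hφ σ hσ
    exact ⟨c • l, fun x hx => by simp [hl x hx]⟩

/-- Restriction of a linear function on `V` to the support of `X`. -/
def restrict (X : MarkedCones ι V) : (V →ₗ[ℝ] ℝ) →ₗ[ℝ] X.PL where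
  toFun l := ⟨fun x => l x, fun _ _ => ⟨l, fun _ _ => rfl⟩⟩
  map_add' _ _ := rfl
  map_smul' _ _ := rfl

/-- The space of divisors `D(X) = PL(X) / L(X)`. -/
abbrev Divisor (X : MarkedCones ι V) : Type _ :=
  X.PL ⧸ LinearMap.range X.restrict

/-- The divisor represented by a piecewise linear function. -/
def divisor (X : MarkedCones ι V) (φ : X.PL) : X.Divisor :=
  (LinearMap.range X.restrict).mkQ φ

/-- A chosen piecewise linear function representing a divisor. -/
noncomputable def rep (X : MarkedCones ι V) (D : X.Divisor) : X.PL :=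
  Function.surjInv (LinearMap.range X.restrict).mkQ_surjective D

/-- A linear function `φ_σ` on `V` that agrees with `φ` on the cone `σ` (zero if `σ` is not a
cone of `X`). -/
noncomputable def linearOn (X : MarkedCones ι V) (φ : X.PL) (σ : Finset ι) : V →ₗ[ℝ] ℝ :=
  if h : σ ∈ X.faces then (φ.2 σ h).choose else 0

/-- The weight `D · ω`. On a Minkowski `k`-weight `ω` and a cone `τ` of dimension `k - 1` its value
is independent of the chosen representative `φ` of `D` and of the chosen linear functions. -/
noncomputable def act (X : MarkedCones ι V) (D : X.Divisor) (ω : Finset ι → ℝ) : Finset ι → ℝ :=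
  fun τ =>
    ∑ ρ ∈ X.link τ, X.linearOn (X.rep D) (insert ρ τ) (ω (insert ρ τ) • X.mark ρ)
      - X.linearOn (X.rep D) τ (∑ ρ ∈ X.link τ, ω (insert ρ τ) • X.mark ρ)

/-- The mixed degree `deg (D₁ ⋯ D_d) = (D₁ ⋯ D_d · ω)(0)` with respect to a Minkowski `d`-weight
`ω`, where `d` is the length of the list. -/
noncomputable def deg (X : MarkedCones ι V) (ω : Finset ι → ℝ) (D : List X.Divisor) : ℝ :=
  D.foldr X.act ω ∅

/-- A divisor is strictly convex if, for every cone `τ`, it has a representative that vanishes on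
`τ` and is strictly positive on all cones containing `τ` as a face, outside `τ`. -/
def IsStrictlyConvex (X : MarkedCones ι V) (D : X.Divisor) : Prop :=
  ∀ τ ∈ X.faces, ∃ φ : X.PL, X.divisor φ = D ∧
    (∀ x : X.support, (x : V) ∈ X.cone τ → φ.1 x = 0) ∧
    ∀ σ ∈ X.faces, τ ⊆ σ → ∀ x : X.support, (x : V) ∈ X.cone σ → (x : V) ∉ X.cone τ → 0 < φ.1 x

/-- `X` is quasiprojective if it carries a strictly convex divisor. -/
def IsQuasiprojective (X : MarkedCones ι V) : Prop :=
  ∃ D, X.IsStrictlyConvex D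

/-! ## Stars -/

/-- The star at `τ`, a family of cones in `V ⧸ V_τ` marked by the images of the marks. Its cones are
the images of the cones `π ∪ τ` of `X`; the ray set of such an image is `π` (disjoint from `τ`). -/
def star (X : MarkedCones ι V) (τ : Finset ι) : MarkedCones ι (V ⧸ X.coneSpan τ) where
  faces := X.faces.filter (fun π => Disjoint π τ ∧ π ∪ τ ∈ X.faces)
  mark ρ := (X.coneSpan τ).mkQ (X.mark ρ)

/-- The weight `ω^τ` induced by `ω` on the star at `τ`. -/
def starWeight (ω : Finset ι → ℝ) (τ : Finset ι) : Finset ι → ℝ :=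
  fun π => ω (π ∪ τ)

/-! ## Lorentzian fans -/

/-- The function `b` of two variables is a symmetric bilinear form of signature `(1, q, r)` for
some `q` and `r`. -/
def HasOnePositiveEigenvalue {W : Type*} [AddCommGroup W] [Module ℝ W] (b : W → W → ℝ) : Prop :=
  ∃ B : LinearMap.BilinForm ℝ W, (∀ x y, B x y = b x y) ∧ B.IsSymm ∧
    sigPos (LinearMap.BilinMap.toQuadraticMap B) = 1

/-- `(X, ω)` is a marked tropical `d`-fan that is Lorentzian. The list `L` stands for the strictly
convex divisors `D₃, …, D_{d^τ}` on the star at `τ`, where `d^τ = d - dim τ` is at least two. -/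
structure IsLorentzianMarked (X : MarkedCones ι V) (d : ℕ) (ω : Finset ι → ℝ) : Prop where
  tropical : X.IsTropical d ω
  quasiprojective : X.IsQuasiprojective
  signature : ∀ τ ∈ X.faces, ∀ L : List (X.star τ).Divisor,
    (∀ D ∈ L, (X.star τ).IsStrictlyConvex D) → L.length + 2 + τ.card = d →
      HasOnePositiveEigenvalue
        (fun D₁ D₂ => (X.star τ).deg (starWeight ω τ) (D₁ :: D₂ :: L))

/-- The same family of cones with each mark `u_ρ` replaced by `c_ρ u_ρ`. -/
def rescale (X : MarkedCones ι V) (c : ι → ℝ) : MarkedCones ι V where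
  faces := X.faces
  mark ρ := c ρ • X.mark ρ

/-- The weight with respect to the marking `c u` that is equivalent to the weight `ω` with respect
to the marking `u`. -/
noncomputable def rescaleWeight (c : ι → ℝ) (ω : Finset ι → ℝ) : Finset ι → ℝ :=
  fun σ => (∏ ρ ∈ σ, (c ρ)⁻¹) * ω σ

/-- The tropical fan represented by `(X, ω)` is Lorentzian: each of its representatives, one for
each marking of the underlying fan, is Lorentzian. -/
def IsLorentzian (X : MarkedCones ι V) (d : ℕ) (ω : Finset ι → ℝ) : Prop :=
  ∀ c : ι → ℝ, (∀ ρ, 0 < c ρ) → (X.rescale c).IsLorentzianMarked d (rescaleWeight c ω)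

end MarkedCones

/-! ## The Bergman fan of a matroid -/

namespace Matroid

variable {α : Type*} (M : Matroid α)

/-- The nonempty proper flats of `M`, ordered by inclusion. -/
abbrev ProperFlat : Type _ := {F : Set α // M.IsFlat F ∧ F.Nonempty ∧ F ≠ M.E}

instance [M.Finite] : Finite M.ProperFlat :=
  (M.ground_finite.finite_subsets.subset (fun _ hF => hF.1.subset_ground)).to_subtype

noncomputable instance : DecidableEq M.ProperFlat := Classical.decEq _

/-- The ambient space `ℝ^E / ℝ(1, …, 1)` of the Bergman fan. -/
abbrev BergmanSpace : Type _ :=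
  (M.E → ℝ) ⧸ Submodule.span ℝ {(fun _ => 1 : M.E → ℝ)}

/-- The Bergman fan of `M`: its rays are indexed by the nonempty proper flats `F` and marked by the
classes of the indicator vectors `e_F`; its cones are generated by the marks of the rays in a flag
`F₁ ⊊ ⋯ ⊊ F_k`, for all flags (including the empty one). -/
noncomputable def bergmanFan [M.Finite] : MarkedCones M.ProperFlat M.BergmanSpace where
  faces := (Set.toFinite {σ : Finset M.ProperFlat | IsChain (· ≤ ·) (σ : Set M.ProperFlat)}).toFinset
  mark F := Submodule.Quotient.mk (fun e => F.1.indicator (fun _ => (1 : ℝ)) e)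

end Matroid

/-! The Lorentzian property is proved by a local-to-global argument. A piecewise linear function on
a simplicial fan is handled through its values at the marks, an element of `ι → ℝ`. Adding a linear
function does not change its action on Minkowski weights, so it may be normalised to vanish on a
given cone τ. Then the degree at τ is a combination of degrees at the cones `insert ρ τ`, which
gives commutativity of the action and, by induction, positivity of mixed degrees of strictly convex
functions (`IsTropical.rayDeg_pos`).

Since the degree form with strictly convex entries has a positive vector, exactly one positive
eigenvalue follows from the reverse Cauchy–Schwarz inequality B(x,x) B(y,y) ≤ B(x,y)² for B(y,y) >
0. `IsTropical.rayDeg_mul_le` proves this inequality by induction on the dimension of the star. For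
a strictly convex φ among the remaining entries, the matrix of B on the rays of the star has
nonnegative off-diagonal entries and connected support, and φ supplies a Perron vector. Expanding
B(x,x) along φ and applying the induction hypothesis on the smaller stars gives a Bochner type
inequality. It excludes eigenvalues strictly between 0 and 1 of the normalised matrix, while the
Perron eigenvalue 1 is the largest and is simple. Hence B is negative semidefinite on the hyperplane
B(φ, ·) = 0.

For the Bergman fan three inputs remain. The differences of coordinates form a family of linear
functions that do not change sign on any cone; the sum of their absolute values is strictly convex,
and this passes to stars. Stars of dimension at least three are connected, by joins of flats. On a
two-dimensional star the degree form is either a square minus a sum of squares, because two points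
of a rank three lattice span one line, or a product of two linear forms up to a factor. -/

section

open Finset

set_option linter.unusedSectionVars false

/-! ### Minkowski weights, the action of piecewise linear functions, and mixed degrees. -/

namespace MarkedCones

variable {ι V : Type*} [DecidableEq ι] [AddCommGroup V] [Module ℝ V]

lemma mem_link {X : MarkedCones ι V} {τ : Finset ι} {ρ : ι} :
    ρ ∈ X.link τ ↔ ρ ∉ τ ∧ insert ρ τ ∈ X.faces := by
  simp only [link, mem_filter, mem_biUnion, id, and_iff_right_iff_imp]
  exact fun h => ⟨_, h.2, mem_insert_self _ _⟩

lemma mem_link_comm {X : MarkedCones ι V} {d : ℕ} (hX : X.IsSimplicialFan d) {τ : Finset ι}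
    {ρ η : ι} : ρ ∈ X.link τ ∧ η ∈ X.link (insert ρ τ) ↔
      ρ ∈ X.link (insert η τ) ∧ η ∈ X.link τ := by
  simp only [mem_link, mem_insert, not_or]
  constructor
  · rintro ⟨⟨h1, h2⟩, ⟨h3, h4⟩, h5⟩
    rw [Finset.insert_comm] at h5
    exact ⟨⟨⟨Ne.symm h3, h1⟩, h5⟩, h4, hX.down_closed _ h5 _ (subset_insert _ _)⟩
  · rintro ⟨⟨⟨h1, h2⟩, h3⟩, h4, h5⟩
    rw [Finset.insert_comm] at h3
    exact ⟨⟨h2, hX.down_closed _ h3 _ (subset_insert _ _)⟩, ⟨Ne.symm h1, h4⟩, h3⟩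

lemma IsSimplicialFan.exists_linear {X : MarkedCones ι V} {d : ℕ} (hX : X.IsSimplicialFan d)
    {σ : Finset ι} (hσ : σ ∈ X.faces) (φ : ι → ℝ) :
    ∃ l : V →ₗ[ℝ] ℝ, ∀ ρ ∈ σ, l (X.mark ρ) = φ ρ := by
  have h : LinearIndependent ℝ (fun ρ : (σ : Set ι) => X.mark ρ) := hX.indep σ hσ
  obtain ⟨l, hl⟩ := LinearMap.exists_extend
    ((Module.Basis.span h).constr ℝ (fun ρ : (σ : Set ι) => φ ρ))
  refine ⟨l, fun ρ hρ => ?_⟩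
  have h1 := LinearMap.congr_fun hl ((Module.Basis.span h) ⟨ρ, hρ⟩)
  rw [Module.Basis.constr_basis, LinearMap.comp_apply, Submodule.subtype_apply,
    Module.Basis.span_apply] at h1
  exact h1

lemma eq_zero_of_mem_coneSpan {X : MarkedCones ι V} {τ : Finset ι} {l : V →ₗ[ℝ] ℝ}
    (hl : ∀ ρ ∈ τ, l (X.mark ρ) = 0) {v : V} (hv : v ∈ X.coneSpan τ) : l v = 0 := by
  have : X.coneSpan τ ≤ LinearMap.ker l := by
    rw [coneSpan, Submodule.span_le]
    rintro _ ⟨ρ, hρ, rfl⟩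
    exact hl ρ hρ
  exact this hv

open Classical in
/-- A linear function that takes the values of `φ` on the marks of the rays in `τ`. -/
noncomputable def extend (X : MarkedCones ι V) (φ : ι → ℝ) (τ : Finset ι) : V →ₗ[ℝ] ℝ :=
  if h : ∃ l : V →ₗ[ℝ] ℝ, ∀ ρ ∈ τ, l (X.mark ρ) = φ ρ then h.choose else 0

lemma IsSimplicialFan.extend_mark {X : MarkedCones ι V} {d : ℕ} (hX : X.IsSimplicialFan d)
    {τ : Finset ι} (hτ : τ ∈ X.faces) (φ : ι → ℝ) {ρ : ι} (hρ : ρ ∈ τ) :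
    X.extend φ τ (X.mark ρ) = φ ρ := by
  have h := hX.exists_linear hτ φ
  rw [extend, dif_pos h]
  exact h.choose_spec ρ hρ

/-- The action on weights of the piecewise linear function with value `φ ρ` at the mark of the
ray `ρ`. -/
noncomputable def rayAct (X : MarkedCones ι V) (φ : ι → ℝ) (ω : Finset ι → ℝ) : Finset ι → ℝ :=
  fun τ => ∑ ρ ∈ X.link τ, ω (insert ρ τ) * (φ ρ - X.extend φ τ (X.mark ρ))

variable {X : MarkedCones ι V} {d k : ℕ} {ω : Finset ι → ℝ} {τ : Finset ι}

lemma rayAct_congr {ω' : Finset ι → ℝ} (φ : ι → ℝ)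
    (h : ∀ ρ ∈ X.link τ, ω (insert ρ τ) = ω' (insert ρ τ)) :
    X.rayAct φ ω τ = X.rayAct φ ω' τ :=
  sum_congr rfl fun ρ hρ => by rw [h ρ hρ]

lemma card_insert_of_mem_link {ρ : ι} (hρ : ρ ∈ X.link τ) : (insert ρ τ).card = τ.card + 1 :=
  card_insert_of_notMem (mem_link.1 hρ).1

lemma sum_link_mul_eq_zero (hω : X.IsMinkowskiWeight (k + 1) ω) (hτ : τ ∈ X.faces)
    (hk : τ.card = k) {l : V →ₗ[ℝ] ℝ} (hl : ∀ η ∈ τ, l (X.mark η) = 0) :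
    ∑ ρ ∈ X.link τ, ω (insert ρ τ) * l (X.mark ρ) = 0 := by
  have h := eq_zero_of_mem_coneSpan hl (hω τ hτ (by rw [hk]))
  simpa using h

/-- By balancing, two linear functions that agree on τ give the same sum over the link. So `extend`
may be replaced by whichever interpolating function is convenient. -/
lemma rayAct_eq (hX : X.IsSimplicialFan d) (hω : X.IsMinkowskiWeight (k + 1) ω)
    (hτ : τ ∈ X.faces) (hk : τ.card = k) {φ : ι → ℝ} {l : V →ₗ[ℝ] ℝ}
    (hl : ∀ η ∈ τ, l (X.mark η) = φ η) :
    X.rayAct φ ω τ = ∑ ρ ∈ X.link τ, ω (insert ρ τ) * (φ ρ - l (X.mark ρ)) := by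
  have h := sum_link_mul_eq_zero hω hτ hk (l := l - X.extend φ τ) (fun η hη => by
    simp [hl η hη, hX.extend_mark hτ φ hη])
  rw [rayAct, ← sub_eq_zero, ← sum_sub_distrib, ← h]
  refine sum_congr rfl fun ρ _ => ?_
  simp only [LinearMap.sub_apply]
  ring

lemma rayAct_eq_of_vanish (hX : X.IsSimplicialFan d) (hω : X.IsMinkowskiWeight (k + 1) ω)
    (hτ : τ ∈ X.faces) (hk : τ.card = k) {φ : ι → ℝ} (hφ : ∀ η ∈ τ, φ η = 0) :
    X.rayAct φ ω τ = ∑ ρ ∈ X.link τ, ω (insert ρ τ) * φ ρ := by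
  rw [rayAct_eq hX hω hτ hk (l := 0) (fun η hη => by simp [hφ η hη])]
  simp

lemma rayAct_congr_left (hX : X.IsSimplicialFan d) (hω : X.IsMinkowskiWeight (k + 1) ω)
    (hτ : τ ∈ X.faces) (hk : τ.card = k) {φ ψ : ι → ℝ} {l : V →ₗ[ℝ] ℝ}
    (h : ∀ ρ ∈ τ, φ ρ = ψ ρ + l (X.mark ρ)) (h' : ∀ ρ ∈ X.link τ, φ ρ = ψ ρ + l (X.mark ρ)) :
    X.rayAct φ ω τ = X.rayAct ψ ω τ := by
  rw [rayAct_eq hX hω hτ hk (φ := φ) (l := X.extend ψ τ + l) (fun η hη => by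
    simp [h η hη, hX.extend_mark hτ ψ hη]), rayAct]
  refine sum_congr rfl fun ρ hρ => ?_
  rw [h' ρ hρ, LinearMap.add_apply]
  ring

lemma rayAct_add (hX : X.IsSimplicialFan d) (hω : X.IsMinkowskiWeight (k + 1) ω)
    (hτ : τ ∈ X.faces) (hk : τ.card = k) (φ ψ : ι → ℝ) :
    X.rayAct (φ + ψ) ω τ = X.rayAct φ ω τ + X.rayAct ψ ω τ := by
  rw [rayAct_eq hX hω hτ hk (φ := φ + ψ) (l := X.extend φ τ + X.extend ψ τ) (fun η hη => by
    simp [hX.extend_mark hτ _ hη]), rayAct, rayAct, ← sum_add_distrib]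
  refine sum_congr rfl fun ρ hρ => ?_
  rw [LinearMap.add_apply, Pi.add_apply]
  ring

lemma rayAct_smul (hX : X.IsSimplicialFan d) (hω : X.IsMinkowskiWeight (k + 1) ω)
    (hτ : τ ∈ X.faces) (hk : τ.card = k) (c : ℝ) (φ : ι → ℝ) :
    X.rayAct (c • φ) ω τ = c * X.rayAct φ ω τ := by
  rw [rayAct_eq hX hω hτ hk (φ := c • φ) (l := c • X.extend φ τ) (fun η hη => by
    simp [hX.extend_mark hτ _ hη]), rayAct, mul_sum]
  refine sum_congr rfl fun ρ hρ => ?_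
  rw [LinearMap.smul_apply, Pi.smul_apply, smul_eq_mul, smul_eq_mul]
  ring

lemma sum_link_sum_link_comm (hX : X.IsSimplicialFan d) (g : ι → ι → ℝ) :
    ∑ ρ ∈ X.link τ, ∑ η ∈ X.link (insert ρ τ), g ρ η =
      ∑ ρ ∈ X.link τ, ∑ η ∈ X.link (insert ρ τ), g η ρ :=
  sum_comm' fun _ _ => mem_link_comm hX

/-- Evaluating the action at `insert ρ τ` yields a sum of x ρ * y η over ordered pairs of rays
spanning a cone with τ, minus a diagonal term in x ρ * y ρ. The first is symmetric by exchanging ρ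
and η, the second visibly. Both balancing of `rayAct` and commutativity come from this symmetry. -/
lemma sum_link_mul_rayAct_comm (hX : X.IsSimplicialFan d)
    (hω : X.IsMinkowskiWeight (k + 2) ω) (hk : τ.card = k) {x y : ι → ℝ}
    (hx : ∀ η ∈ τ, x η = 0) (hy : ∀ η ∈ τ, y η = 0) :
    ∑ ρ ∈ X.link τ, X.rayAct y ω (insert ρ τ) * x ρ =
      ∑ ρ ∈ X.link τ, X.rayAct x ω (insert ρ τ) * y ρ := by
  have key : ∀ x y : ι → ℝ, (∀ η ∈ τ, y η = 0) →
      ∑ ρ ∈ X.link τ, X.rayAct y ω (insert ρ τ) * x ρ =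
      (∑ ρ ∈ X.link τ, ∑ η ∈ X.link (insert ρ τ), ω (insert η (insert ρ τ)) * (x ρ * y η)) -
      ∑ ρ ∈ X.link τ, (x ρ * y ρ) * ∑ η ∈ X.link (insert ρ τ), ω (insert η (insert ρ τ)) *
        X.extend (Pi.single ρ 1) (insert ρ τ) (X.mark η) := by
    intro x y hy
    rw [← sum_sub_distrib]
    refine sum_congr rfl fun ρ hρ => ?_
    have hf := (mem_link.1 hρ).2
    -- Since y vanishes on τ, the multiple by y ρ of the function dual to ρ interpolates y on
    -- `insert ρ τ`.
    rw [rayAct_eq hX hω hf ((card_insert_of_mem_link hρ).trans (by rw [hk])) (φ := y)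
      (l := y ρ • X.extend (Pi.single ρ 1) (insert ρ τ)), sum_mul, mul_sum, ← sum_sub_distrib]
    · refine sum_congr rfl fun η hη => ?_
      simp only [LinearMap.smul_apply, smul_eq_mul]
      ring
    · intro η hη
      rw [LinearMap.smul_apply, hX.extend_mark hf _ hη]
      rcases mem_insert.1 hη with rfl | h
      · simp
      · have : η ≠ ρ := fun e => (mem_link.1 hρ).1 (e ▸ h)
        simp [this, hy η h]
  rw [key x y hy, key y x hx, sum_link_sum_link_comm hX]
  congr 1
  · refine sum_congr rfl fun ρ _ => sum_congr rfl fun η _ => ?_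
    rw [Finset.insert_comm]; ring
  · exact sum_congr rfl fun ρ _ => by ring

/-- Balancing at τ is tested by linear functions m that vanish on the span of τ. By the symmetry
above, m may be exchanged with the normalised φ, and m acts as zero because it is linear. -/
lemma IsMinkowskiWeight.rayAct (hX : X.IsSimplicialFan d)
    (hω : X.IsMinkowskiWeight (k + 1) ω) (φ : ι → ℝ) :
    X.IsMinkowskiWeight k (X.rayAct φ ω) := by
  intro τ hτ hk
  subst hk
  by_contra hcon
  obtain ⟨m, hm, hle⟩ := Submodule.exists_le_ker_of_notMem hcon
  refine hm ?_
  have hm0 : ∀ η ∈ τ, m (X.mark η) = 0 := fun η hη =>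
    hle (Submodule.subset_span ⟨η, hη, rfl⟩)
  set ψ : ι → ℝ := fun ρ => φ ρ - X.extend φ τ (X.mark ρ) with hψ
  have hψ0 : ∀ η ∈ τ, ψ η = 0 := fun η hη => by simp [hψ, hX.extend_mark hτ φ hη]
  have h1 := sum_link_mul_rayAct_comm hX hω rfl (x := fun ρ => m (X.mark ρ)) hm0 hψ0
  have h2 : ∀ ρ ∈ X.link τ, X.rayAct ψ ω (insert ρ τ) = X.rayAct φ ω (insert ρ τ) := by
    intro ρ hρ
    symm
    exact rayAct_congr_left hX hω (mem_link.1 hρ).2 (card_insert_of_mem_link hρ)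
      (l := X.extend φ τ) (fun _ _ => by simp [hψ]) (fun _ _ => by simp [hψ])
  have h3 : ∀ ρ ∈ X.link τ, X.rayAct (fun ρ => m (X.mark ρ)) ω (insert ρ τ) = 0 := by
    intro ρ hρ
    rw [rayAct_eq hX hω (mem_link.1 hρ).2 (card_insert_of_mem_link hρ) (l := m)
      (fun _ _ => rfl)]
    simp
  rw [sum_congr rfl fun ρ hρ => by rw [h2 ρ hρ]] at h1
  simpa using h1.trans (sum_eq_zero fun ρ hρ => by rw [h3 ρ hρ, zero_mul])

/-- Both functions are normalised to vanish on τ, which does not change their action on the larger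
cones; then the symmetry of the double sum applies. -/
lemma rayAct_comm (hX : X.IsSimplicialFan d)
    (hω : X.IsMinkowskiWeight (k + 2) ω) (hτ : τ ∈ X.faces) (hk : τ.card = k) (φ ψ : ι → ℝ) :
    X.rayAct φ (X.rayAct ψ ω) τ = X.rayAct ψ (X.rayAct φ ω) τ := by
  have h2 : ∀ φ : ι → ℝ, ∀ ρ ∈ X.link τ,
      X.rayAct (fun ρ => φ ρ - X.extend φ τ (X.mark ρ)) ω (insert ρ τ) =
        X.rayAct φ ω (insert ρ τ) := by
    intro φ ρ hρ
    symm
    exact rayAct_congr_left hX hω (mem_link.1 hρ).2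
      ((card_insert_of_mem_link hρ).trans (by rw [hk]))
      (l := X.extend φ τ) (fun _ _ => by simp) (fun _ _ => by simp)
  have h1 := sum_link_mul_rayAct_comm hX hω hk
    (x := fun ρ => φ ρ - X.extend φ τ (X.mark ρ)) (y := fun ρ => ψ ρ - X.extend ψ τ (X.mark ρ))
    (fun η hη => by simp [hX.extend_mark hτ φ hη]) (fun η hη => by simp [hX.extend_mark hτ ψ hη])
  rw [sum_congr rfl fun ρ hρ => by rw [h2 ψ ρ hρ]] at h1
  rw [rayAct, h1]
  exact sum_congr rfl fun ρ hρ => by rw [h2 φ ρ hρ]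

/-- The mixed degree of piecewise linear functions, given by their values at the marks, at the
star of `τ`. -/
noncomputable def rayDeg (X : MarkedCones ι V) (ω : Finset ι → ℝ) (τ : Finset ι)
    (L : List (ι → ℝ)) : ℝ :=
  L.foldr X.rayAct ω τ

lemma IsMinkowskiWeight.foldr (hX : X.IsSimplicialFan d) :
    ∀ (L : List (ι → ℝ)) {k : ℕ}, X.IsMinkowskiWeight (k + L.length) ω →
      X.IsMinkowskiWeight k (L.foldr X.rayAct ω)
  | [], _, h => h
  | φ :: L, k, h => by
    refine IsMinkowskiWeight.rayAct hX (IsMinkowskiWeight.foldr hX L ?_) φ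
    rwa [List.length_cons, add_comm L.length, ← add_assoc] at h

section

variable (hX : X.IsSimplicialFan d) (hω : X.IsMinkowskiWeight d ω) (hτ : τ ∈ X.faces)
include hX hω hτ

lemma rayDeg_cons {L : List (ι → ℝ)} (hL : τ.card + 1 + L.length = d)
    {φ : ι → ℝ} {l : V →ₗ[ℝ] ℝ} (hl : ∀ η ∈ τ, l (X.mark η) = φ η) :
    X.rayDeg ω τ (φ :: L) =
      ∑ ρ ∈ X.link τ, X.rayDeg ω (insert ρ τ) L * (φ ρ - l (X.mark ρ)) :=
  rayAct_eq hX (IsMinkowskiWeight.foldr hX L (by rwa [hL])) hτ rfl hl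

lemma rayDeg_cons_of_vanish {L : List (ι → ℝ)} (hL : τ.card + 1 + L.length = d)
    {φ : ι → ℝ} (hφ : ∀ η ∈ τ, φ η = 0) :
    X.rayDeg ω τ (φ :: L) = ∑ ρ ∈ X.link τ, X.rayDeg ω (insert ρ τ) L * φ ρ :=
  rayAct_eq_of_vanish hX (IsMinkowskiWeight.foldr hX L (by rwa [hL])) hτ rfl hφ

lemma rayDeg_congr_head {L : List (ι → ℝ)} (hL : τ.card + 1 + L.length = d)
    {φ ψ : ι → ℝ} {l : V →ₗ[ℝ] ℝ} (h : ∀ ρ ∈ τ, φ ρ = ψ ρ + l (X.mark ρ))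
    (h' : ∀ ρ ∈ X.link τ, φ ρ = ψ ρ + l (X.mark ρ)) :
    X.rayDeg ω τ (φ :: L) = X.rayDeg ω τ (ψ :: L) :=
  rayAct_congr_left hX (IsMinkowskiWeight.foldr hX L (by rwa [hL])) hτ rfl h h'

lemma rayDeg_add_head {L : List (ι → ℝ)} (hL : τ.card + 1 + L.length = d) (φ ψ : ι → ℝ) :
    X.rayDeg ω τ ((φ + ψ) :: L) = X.rayDeg ω τ (φ :: L) + X.rayDeg ω τ (ψ :: L) :=
  rayAct_add hX (IsMinkowskiWeight.foldr hX L (by rwa [hL])) hτ rfl _ _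

lemma rayDeg_smul_head {L : List (ι → ℝ)} (hL : τ.card + 1 + L.length = d) (c : ℝ) (φ : ι → ℝ) :
    X.rayDeg ω τ ((c • φ) :: L) = c * X.rayDeg ω τ (φ :: L) :=
  rayAct_smul hX (IsMinkowskiWeight.foldr hX L (by rwa [hL])) hτ rfl _ _

lemma rayDeg_swap {L : List (ι → ℝ)} (hL : τ.card + 2 + L.length = d) (φ ψ : ι → ℝ) :
    X.rayDeg ω τ (φ :: ψ :: L) = X.rayDeg ω τ (ψ :: φ :: L) :=
  rayAct_comm hX (IsMinkowskiWeight.foldr hX L (by rwa [hL])) hτ rfl _ _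

omit hτ in
lemma rayDeg_rotate (hτ : τ ∈ X.faces) {L : List (ι → ℝ)} (hL : τ.card + 3 + L.length = d)
    (φ ψ χ : ι → ℝ) :
    X.rayDeg ω τ (φ :: ψ :: χ :: L) = X.rayDeg ω τ (χ :: φ :: ψ :: L) := by
  -- The inner two entries are exchanged at each cone `insert ρ τ`, where one factor fewer is left.
  have h : X.rayDeg ω τ (φ :: ψ :: χ :: L) = X.rayDeg ω τ (φ :: χ :: ψ :: L) := by
    refine rayAct_congr φ fun ρ hρ => ?_
    refine rayDeg_swap hX hω (mem_link.1 hρ).2 ?_ _ _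
    rw [card_insert_of_mem_link hρ]
    omega
  rw [h]
  exact rayDeg_swap hX hω hτ (by simp; omega) _ _

/-- The bilinear form of mixed degrees, as a function of its first two arguments. -/
lemma rayDeg_bilin {L : List (ι → ℝ)} (hL : τ.card + 2 + L.length = d) :
    ∃ B : LinearMap.BilinForm ℝ (ι → ℝ), B.IsSymm ∧
      ∀ φ ψ, B φ ψ = X.rayDeg ω τ (φ :: ψ :: L) := by
  have h1 : ∀ ψ : ι → ℝ, τ.card + 1 + (ψ :: L).length = d := fun ψ => by simp; omega
  refine ⟨LinearMap.mk₂ ℝ (fun φ ψ => X.rayDeg ω τ (φ :: ψ :: L)) ?_ ?_ ?_ ?_, ⟨?_⟩, ?_⟩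
  · exact fun φ φ' ψ => rayDeg_add_head hX hω hτ (h1 ψ) _ _
  · exact fun c φ ψ => rayDeg_smul_head hX hω hτ (h1 ψ) _ _
  · intro φ ψ ψ'
    rw [rayDeg_swap hX hω hτ hL, rayDeg_add_head hX hω hτ (h1 φ), rayDeg_swap hX hω hτ hL,
      rayDeg_swap hX hω hτ hL ψ']
  · intro c φ ψ
    rw [rayDeg_swap hX hω hτ hL, rayDeg_smul_head hX hω hτ (h1 φ), rayDeg_swap hX hω hτ hL]
    rfl
  · exact fun φ ψ => rayDeg_swap hX hω hτ hL _ _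
  · exact fun φ ψ => rfl

end

/-- Strict convexity, near `τ`, of the piecewise linear function with value `φ ρ` at the mark of
the ray `ρ`. -/
def ConvexAt (X : MarkedCones ι V) (τ : Finset ι) (φ : ι → ℝ) : Prop :=
  ∀ π ∈ X.faces, τ ⊆ π → ∃ l : V →ₗ[ℝ] ℝ,
    (∀ η ∈ π, l (X.mark η) = φ η) ∧ ∀ ρ ∈ X.link π, l (X.mark ρ) < φ ρ

lemma ConvexAt.mono {τ π : Finset ι} {φ : ι → ℝ} (h : X.ConvexAt τ φ) (hτ : τ ⊆ π) :
    X.ConvexAt π φ :=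
  fun σ hσ hπ => h σ hσ (hτ.trans hπ)

lemma IsSimplicialFan.link_nonempty (hX : X.IsSimplicialFan d) (hτ : τ ∈ X.faces)
    (h : τ.card < d) : (X.link τ).Nonempty := by
  obtain ⟨σ, hσ, hm⟩ := (X.faces : Set (Finset ι)).toFinite.exists_le_maximal hτ
  have h1 : τ ⊂ σ := lt_of_le_of_ne hσ (by
    rintro rfl
    exact h.ne (hX.pure _ hm))
  obtain ⟨ρ, hρ, hρτ⟩ := exists_of_ssubset h1
  exact ⟨ρ, mem_link.2 ⟨hρτ, hX.down_closed _ hm.1 _ (insert_subset hρ h1.1)⟩⟩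

/-- After subtracting the linear function given by convexity at τ, the first entry is positive on
the link. The degree is then a positive combination of degrees at larger cones, and the link is
nonempty by purity. -/
lemma IsTropical.rayDeg_pos (hX : X.IsTropical d ω) :
    ∀ (L : List (ι → ℝ)) {τ : Finset ι}, τ ∈ X.faces → τ.card + L.length = d →
      (∀ φ ∈ L, X.ConvexAt τ φ) → 0 < X.rayDeg ω τ L
  | [], τ, hτ, hc, _ => hX.pos τ hτ hc
  | φ :: L, τ, hτ, hc, hL => by
    obtain ⟨l, hl, hl'⟩ := hL φ List.mem_cons_self τ hτ subset_rfl
    rw [List.length_cons] at hc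
    rw [rayDeg_cons hX.fan hX.balanced hτ (by omega) hl]
    refine sum_pos (fun ρ hρ => mul_pos ?_ (sub_pos.2 (hl' ρ hρ)))
      (hX.fan.link_nonempty hτ (by omega))
    refine IsTropical.rayDeg_pos hX L (mem_link.1 hρ).2 ?_
      (fun ψ hψ => (hL ψ (List.mem_cons_of_mem _ hψ)).mono (subset_insert _ _))
    rw [card_insert_of_mem_link hρ]
    omega

end MarkedCones

/-! ### Linear algebra: a Perron–Frobenius argument and the reverse Cauchy–Schwarz inequality. -/

/-- A symmetric operator `T` with `T ≤ T ^ 2` and `T ≤ 1` whose fixed vectors are multiples of `a`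
is negative semidefinite on the orthogonal complement of `a`. -/
lemma LinearMap.IsSymmetric.inner_nonpos_of_inner_eq_zero {E : Type*} [NormedAddCommGroup E]
    [InnerProductSpace ℝ E] [FiniteDimensional ℝ E] {T : E →ₗ[ℝ] E} (hT : T.IsSymmetric) {a : E}
    (h₁ : ∀ x, inner ℝ (T x) x ≤ inner ℝ (T x) (T x)) (h₂ : ∀ x, inner ℝ (T x) x ≤ inner ℝ x x)
    (h₃ : ∀ x, T x = x → ∃ c : ℝ, x = c • a) {x : E} (hx : inner ℝ a x = 0) :
    inner ℝ (T x) x ≤ 0 := by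
  set e := hT.eigenvectorBasis rfl
  have he : ∀ i, T (e i) = hT.eigenvalues rfl i • e i := fun i =>
    hT.apply_eigenvectorBasis rfl i
  rw [← e.sum_inner_mul_inner]
  refine sum_nonpos fun i _ => ?_
  rw [hT x (e i), he, inner_smul_right, mul_assoc, real_inner_comm (e i) x]
  have hn : inner ℝ (e i) (e i) = (1 : ℝ) := by
    rw [real_inner_self_eq_norm_sq, e.orthonormal.1 i, one_pow]
  have g₁ := h₁ (e i)
  have g₂ := h₂ (e i)
  rw [he, inner_smul_left, hn] at g₂
  rw [he, inner_smul_left, inner_smul_left, inner_smul_right, hn] at g₁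
  simp only [conj_trivial, mul_one] at g₁ g₂
  rcases le_or_gt (hT.eigenvalues rfl i) 0 with h0 | h0
  · exact mul_nonpos_of_nonpos_of_nonneg h0 (mul_self_nonneg _)
  -- A positive eigenvalue λ satisfies λ ≤ λ² and λ ≤ 1, so it is 1; its eigenvector is a multiple
  -- of a, to which x is orthogonal.
  · have h1 : hT.eigenvalues rfl i = 1 := by nlinarith
    obtain ⟨c, hc⟩ := h₃ (e i) (by rw [he, h1, one_smul])
    rw [hc, inner_smul_left, hx]
    simp

/-- The quadratic form of a matrix with nonnegative off-diagonal entries, compared with a diagonal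
form with the same value at `a`. -/
lemma Matrix.sum_sub_sum_eq {R : Type*} [Fintype R] {b : R → R → ℝ}
    (hb : ∀ ρ η, b ρ η = b η ρ) {a w : R → ℝ} (ha : ∀ ρ, 0 < a ρ)
    (haw : ∀ ρ, ∑ η, b ρ η * a η = w ρ) (x : R → ℝ) :
    ∑ ρ, w ρ / a ρ * x ρ ^ 2 - ∑ ρ, x ρ * ∑ η, b ρ η * x η =
      (∑ ρ, ∑ η, b ρ η * (a ρ * a η) * (x ρ / a ρ - x η / a η) ^ 2) / 2 := by
  have h1 : ∑ ρ, w ρ / a ρ * x ρ ^ 2 = ∑ ρ, ∑ η, b ρ η * a η * (x ρ ^ 2 / a ρ) := by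
    refine sum_congr rfl fun ρ _ => ?_
    rw [← sum_mul, haw]
    ring
  have h2 : ∑ ρ, ∑ η, b ρ η * a η * (x ρ ^ 2 / a ρ) =
      ∑ ρ, ∑ η, b ρ η * a ρ * (x η ^ 2 / a η) := by
    rw [sum_comm]
    exact sum_congr rfl fun ρ _ => sum_congr rfl fun η _ => by rw [hb]
  have h3 : ∑ ρ, ∑ η, b ρ η * (a ρ * a η) * (x ρ / a ρ - x η / a η) ^ 2 =
      ∑ ρ, ∑ η, b ρ η * a η * (x ρ ^ 2 / a ρ) + ∑ ρ, ∑ η, b ρ η * a ρ * (x η ^ 2 / a η) -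
        2 * ∑ ρ, x ρ * ∑ η, b ρ η * x η := by
    simp only [mul_sum, ← sum_add_distrib, ← sum_sub_distrib]
    refine sum_congr rfl fun ρ _ => sum_congr rfl fun η _ => ?_
    have := (ha ρ).ne'
    have := (ha η).ne'
    field_simp
    ring
  rw [h3, ← h2, h1]
  ring

/-- A Perron–Frobenius argument: a symmetric matrix with nonnegative off-diagonal entries and
connected support that satisfies a Bochner type inequality is negative semidefinite on a
hyperplane. -/
lemma Matrix.sum_nonpos_of_bochner {R : Type*} [Fintype R] [DecidableEq R] {b : R → R → ℝ}
    (hb : ∀ ρ η, b ρ η = b η ρ) (hb0 : ∀ ρ η, ρ ≠ η → 0 ≤ b ρ η) {a w : R → ℝ}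
    (ha : ∀ ρ, 0 < a ρ) (hw : ∀ ρ, 0 < w ρ) (haw : ∀ ρ, ∑ η, b ρ η * a η = w ρ)
    (hconn : ∀ y : R → ℝ, (∀ ρ η, ρ ≠ η → 0 < b ρ η → y ρ = y η) → ∀ ρ η, y ρ = y η)
    (hQ : ∀ x : R → ℝ, ∑ ρ, x ρ * ∑ η, b ρ η * x η ≤
      ∑ ρ, a ρ / w ρ * (∑ η, b ρ η * x η) ^ 2)
    {x : R → ℝ} (hx : ∑ ρ, w ρ * x ρ = 0) : ∑ ρ, x ρ * ∑ η, b ρ η * x η ≤ 0 := by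
  -- Conjugation by the diagonal matrix s turns b a = w into T (a / s) = a / s, and the Bochner
  -- inequality into T ≤ T².
  set s : R → ℝ := fun ρ => √(a ρ / w ρ) with hs
  have hs0 : ∀ ρ, 0 < s ρ := fun ρ => Real.sqrt_pos.2 (div_pos (ha ρ) (hw ρ))
  have hs2 : ∀ ρ, s ρ ^ 2 = a ρ / w ρ := fun ρ =>
    Real.sq_sqrt (div_pos (ha ρ) (hw ρ)).le
  have hs3 : ∀ ρ, s ρ ^ 2 * w ρ = a ρ := fun ρ => by rw [hs2, div_mul_cancel₀ _ (hw ρ).ne']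
  set S : Matrix R R ℝ := Matrix.of fun ρ η => s ρ * b ρ η * s η with hS
  set T := Matrix.toEuclideanLin S with hTdef
  have hT : T.IsSymmetric := by
    rw [hTdef, Matrix.isSymmetric_toEuclideanLin_iff]
    ext ρ η
    simp only [hS, Matrix.conjTranspose_apply, Matrix.of_apply, star_trivial]
    rw [hb]
    ring
  have hTa : ∀ (z : EuclideanSpace ℝ R) ρ, T z ρ = s ρ * ∑ η, b ρ η * (s η * z η) := by
    intro z ρ
    simp only [hTdef, Matrix.toLpLin_apply, Matrix.mulVec, dotProduct, hS, Matrix.of_apply, mul_sum]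
    exact sum_congr rfl fun η _ => by ring
  have hin : ∀ u v : EuclideanSpace ℝ R, inner ℝ u v = ∑ ρ, u ρ * v ρ := by
    intro u v
    simp only [PiLp.inner_apply, RCLike.inner_apply, conj_trivial]
    exact sum_congr rfl fun ρ _ => mul_comm _ _
  have hTin : ∀ z : EuclideanSpace ℝ R, inner ℝ (T z) z =
      ∑ ρ, (s ρ * z ρ) * ∑ η, b ρ η * (s η * z η) := by
    intro z
    rw [hin]
    exact sum_congr rfl fun ρ _ => by rw [hTa]; ring
  have hzz : ∀ z : EuclideanSpace ℝ R, inner ℝ z z - inner ℝ (T z) z =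
      (∑ ρ, ∑ η, b ρ η * (a ρ * a η) * (s ρ * z ρ / a ρ - s η * z η / a η) ^ 2) / 2 := by
    intro z
    rw [← Matrix.sum_sub_sum_eq hb ha haw, hTin, hin]
    congr 1
    refine sum_congr rfl fun ρ _ => ?_
    rw [mul_pow, hs2]
    have := (ha ρ).ne'
    have := (hw ρ).ne'
    field_simp
  have hterm : ∀ (z : EuclideanSpace ℝ R) ρ η,
      0 ≤ b ρ η * (a ρ * a η) * (s ρ * z ρ / a ρ - s η * z η / a η) ^ 2 := by
    intro z ρ η
    rcases eq_or_ne ρ η with rfl | h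
    · simp
    · exact mul_nonneg (mul_nonneg (hb0 ρ η h) (mul_pos (ha ρ) (ha η)).le) (sq_nonneg _)
  have key := hT.inner_nonpos_of_inner_eq_zero (a := WithLp.toLp 2 fun ρ => a ρ / s ρ)
    (x := WithLp.toLp 2 fun ρ => x ρ / s ρ) ?_ ?_ ?_ ?_
  · rw [hTin] at key
    simpa [mul_div_cancel₀ _ (hs0 _).ne'] using key
  · intro z
    rw [hTin, hin]
    refine (hQ _).trans_eq (sum_congr rfl fun ρ _ => ?_)
    rw [hTa, ← hs2]
    ring
  · intro z
    rw [← sub_nonneg, hzz]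
    exact div_nonneg (sum_nonneg fun ρ _ => sum_nonneg fun η _ => hterm z ρ η) two_pos.le
  -- For a fixed vector the sum of squares in `hzz` vanishes termwise, so s z / a is constant along
  -- the edges of the support of b, hence constant.
  · intro z hz
    have h0 := hzz z
    rw [hz, sub_self, eq_comm, div_eq_zero_iff, or_iff_left (by norm_num),
      sum_eq_zero_iff_of_nonneg fun ρ _ => sum_nonneg fun η _ => hterm z ρ η] at h0
    have hc := hconn (fun ρ => s ρ * z ρ / a ρ) (fun ρ η hne hpos => by
      have h1 := (sum_eq_zero_iff_of_nonneg fun η _ => hterm z ρ η).1 (h0 ρ (mem_univ _)) η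
        (mem_univ _)
      rcases mul_eq_zero.1 h1 with h | h
      · exact absurd h (mul_pos hpos (mul_pos (ha ρ) (ha η))).ne'
      · exact sub_eq_zero.1 (pow_eq_zero_iff two_ne_zero |>.1 h))
    rcases isEmpty_or_nonempty R with hR | ⟨⟨ρ₀⟩⟩
    · exact ⟨0, by ext ρ; exact hR.elim ρ⟩
    · refine ⟨s ρ₀ * z ρ₀ / a ρ₀, ?_⟩
      ext ρ
      rw [PiLp.smul_apply, smul_eq_mul, hc ρ₀ ρ]
      have := (ha ρ).ne'
      have := (hs0 ρ).ne'
      field_simp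
  · rw [hin, ← hx]
    refine sum_congr rfl fun ρ _ => ?_
    have := (hs0 ρ).ne'
    rw [div_mul_div_comm, ← sq, hs2]
    have := (ha ρ).ne'
    have := (hw ρ).ne'
    field_simp

/-- The reverse Cauchy–Schwarz inequality for a form that is negative semidefinite on a
hyperplane of the span of two vectors. -/
lemma LinearMap.BilinForm.IsSymm.mul_le_sq {W : Type*} [AddCommGroup W] [Module ℝ W]
    {B : LinearMap.BilinForm ℝ W} (hB : B.IsSymm) (l : W →ₗ[ℝ] ℝ) {x y : W}
    (h : ∀ s t : ℝ, l (s • x + t • y) = 0 → B (s • x + t • y) (s • x + t • y) ≤ 0)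
    (hy : 0 < B y y) : B x x * B y y ≤ B x y ^ 2 := by
  have hl : l y ≠ 0 := fun h0 => (by simpa [h0] using h 0 1 : B y y ≤ 0).not_gt hy
  -- The vector l(y) x - l(x) y lies in the kernel of l. Expanding the form there and multiplying by
  -- B(y,y), the claim follows by completing a square.
  have h1 := h (l y) (-l x) (by simp [mul_comm])
  have hc : B y x = B x y := hB.eq y x
  simp only [map_add, map_smul, LinearMap.add_apply, LinearMap.smul_apply, smul_eq_mul, hc] at h1
  have h2 : 0 < l y ^ 2 := by positivity
  refine le_of_mul_le_mul_left ?_ h2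
  nlinarith [sq_nonneg (l y * B x y - l x * B y y), mul_le_mul_of_nonneg_right h1 hy.le]

/-! ### The induction on the dimension of the star. -/

namespace MarkedCones

variable {ι V : Type*} [DecidableEq ι] [AddCommGroup V] [Module ℝ V]
variable {X : MarkedCones ι V} {d : ℕ} {ω : Finset ι → ℝ}

/-- Mixed degrees on a tropical fan satisfy the reverse Cauchy–Schwarz inequality if they do so on
its two-dimensional stars and its stars of higher dimension are connected. -/
theorem IsTropical.rayDeg_mul_le (hX : X.IsTropical d ω)
    (hconn : ∀ τ ∈ X.faces, τ.card + 3 ≤ d → ∀ y : ι → ℝ,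
      (∀ ρ ∈ X.link τ, ∀ η ∈ X.link (insert ρ τ), y ρ = y η) →
      ∀ ρ ∈ X.link τ, ∀ η ∈ X.link τ, y ρ = y η)
    (hbase : ∀ τ ∈ X.faces, τ.card + 2 = d → ∀ x y : ι → ℝ, 0 < X.rayDeg ω τ [y, y] →
      X.rayDeg ω τ [x, x] * X.rayDeg ω τ [y, y] ≤ X.rayDeg ω τ [x, y] ^ 2) :
    ∀ (L : List (ι → ℝ)) {τ : Finset ι}, τ ∈ X.faces → τ.card + 2 + L.length = d →
      (∀ φ ∈ L, X.ConvexAt τ φ) → ∀ x y : ι → ℝ, 0 < X.rayDeg ω τ (y :: y :: L) →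
      X.rayDeg ω τ (x :: x :: L) * X.rayDeg ω τ (y :: y :: L) ≤ X.rayDeg ω τ (x :: y :: L) ^ 2
  | [], τ, hτ, hd, _ => hbase τ hτ hd
  | φ :: L, τ, hτ, hd, hL => by
    intro x y hy
    have hfan := hX.fan
    have hbal := hX.balanced
    obtain ⟨B, hB, hBdef⟩ := rayDeg_bilin hfan hbal hτ hd
    simp only [← hBdef] at hy ⊢
    -- It suffices that the form is negative semidefinite on the hyperplane orthogonal to φ, the
    -- first of the remaining convex entries.
    suffices hneg : ∀ z, B φ z = 0 → B z z ≤ 0 from hB.mul_le_sq (B φ) (fun _ _ => hneg _) hy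
    clear x y hy
    intro z hz
    rw [List.length_cons] at hd
    have hφ : X.ConvexAt τ φ := hL φ List.mem_cons_self
    have hL' : ∀ ψ ∈ L, X.ConvexAt τ ψ := fun ψ hψ => hL ψ (List.mem_cons_of_mem _ hψ)
    obtain ⟨l, hl, hl'⟩ := hφ τ hτ subset_rfl
    have hface : ∀ {ρ}, ρ ∈ X.link τ → insert ρ τ ∈ X.faces := fun hρ => (mem_link.1 hρ).2
    have hcard : ∀ {ρ}, ρ ∈ X.link τ → (insert ρ τ).card = τ.card + 1 :=
      fun hρ => card_insert_of_mem_link hρ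
    -- the form does not change under modifications by linear functions
    have hcongr : ∀ (x x' y : ι → ℝ) (m : V →ₗ[ℝ] ℝ),
        (∀ ρ, ρ ∈ τ ∨ ρ ∈ X.link τ → x ρ = x' ρ + m (X.mark ρ)) → B x y = B x' y := by
      intro x x' y m h
      rw [hBdef, hBdef]
      exact rayDeg_congr_head hfan hbal hτ (by simp; omega) (fun ρ hρ => h ρ (.inl hρ))
        (fun ρ hρ => h ρ (.inr hρ))
    have hsum : ∀ x y : ι → ℝ, (∀ η ∈ τ, x η = 0) →
        B x y = ∑ ρ ∈ X.link τ, X.rayDeg ω (insert ρ τ) (y :: φ :: L) * x ρ := by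
      intro x y hx
      rw [hBdef]
      exact rayDeg_cons_of_vanish hfan hbal hτ (by simp; omega) hx
    have hsingle0 : ∀ {ρ}, ρ ∈ X.link τ → ∀ η ∈ τ, (Pi.single ρ 1 : ι → ℝ) η = 0 := by
      intro ρ hρ η hη
      exact Pi.single_eq_of_ne (fun (e : η = ρ) => (mem_link.1 hρ).1 (e ▸ hη)) _
    have hsingle : ∀ {ρ}, ρ ∈ X.link τ → ∀ y : ι → ℝ,
        B (Pi.single ρ 1) y = X.rayDeg ω (insert ρ τ) (y :: φ :: L) := by
      intro ρ hρ y
      rw [hsum _ y (hsingle0 hρ), sum_eq_single_of_mem ρ hρ (fun η _ hne => by simp [hne])]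
      simp
    -- Vectors indexed by the link, extended by zero to all rays; up to a linear function, every
    -- function agrees with such an extension on τ and its link.
    let ext : (X.link τ → ℝ) → ι → ℝ := fun x => ∑ ρ, x ρ • Pi.single (ρ : ι) 1
    have hext : ∀ x (ρ : X.link τ), ext x ρ = x ρ := by
      intro x ρ
      simp only [ext, Finset.sum_apply, Pi.smul_apply, smul_eq_mul]
      rw [sum_eq_single_of_mem ρ (mem_univ _) (fun η _ hne => by
        simp [Pi.single_eq_of_ne (fun e => hne (Subtype.ext e.symm) : (ρ : ι) ≠ η)])]
      simp
    have hext0 : ∀ x, ∀ η ∈ τ, ext x η = 0 := by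
      intro x η hη
      simp only [ext, Finset.sum_apply, Pi.smul_apply, smul_eq_mul]
      exact sum_eq_zero fun ρ _ => by rw [hsingle0 ρ.2 η hη, mul_zero]
    have hBext : ∀ x (ρ : X.link τ), ∑ η : X.link τ, B (Pi.single (ρ : ι) 1)
        (Pi.single (η : ι) 1) * x η = B (Pi.single (ρ : ι) 1) (ext x) := by
      intro x ρ
      simp only [ext, map_sum, map_smul, smul_eq_mul]
      exact sum_congr rfl fun η _ => mul_comm _ _
    have hBext2 : ∀ x, ∑ ρ : X.link τ, x ρ * B (Pi.single (ρ : ι) 1) (ext x) =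
        B (ext x) (ext x) := by
      intro x
      have h : ∀ y, B (ext x) y = ∑ ρ : X.link τ, x ρ * B (Pi.single (ρ : ι) 1) y := by
        intro y
        simp only [ext, map_sum, map_smul, LinearMap.sum_apply, LinearMap.smul_apply, smul_eq_mul]
      exact (h _).symm
    have hpos : ∀ ρ : X.link τ, 0 < X.rayDeg ω (insert (ρ : ι) τ) (φ :: φ :: L) := by
      intro ρ
      refine hX.rayDeg_pos _ (hface ρ.2) (by rw [hcard ρ.2]; simp; omega) fun ψ hψ => ?_
      refine ConvexAt.mono ?_ (subset_insert _ _)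
      simp only [List.mem_cons] at hψ
      rcases hψ with rfl | rfl | h
      exacts [hφ, hφ, hL' _ h]
    have hoff : ∀ ρ η : X.link τ, ρ ≠ η → B (Pi.single (ρ : ι) 1) (Pi.single (η : ι) 1) =
        if (η : ι) ∈ X.link (insert (ρ : ι) τ) then
          X.rayDeg ω (insert (η : ι) (insert (ρ : ι) τ)) (φ :: L) else 0 := by
      intro ρ η hne
      rw [hsingle ρ.2, rayDeg_cons_of_vanish hfan hbal (hface ρ.2)
        (by rw [hcard ρ.2]; simp; omega)]
      · simp [Pi.single_apply]
      · intro θ hθ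
        rcases mem_insert.1 hθ with rfl | h
        · exact Pi.single_eq_of_ne (fun e => hne (Subtype.ext e)) _
        · exact hsingle0 η.2 θ h
    have hoffpos : ∀ ρ η : X.link τ, (η : ι) ∈ X.link (insert (ρ : ι) τ) →
        0 < X.rayDeg ω (insert (η : ι) (insert (ρ : ι) τ)) (φ :: L) := by
      intro ρ η hη
      refine hX.rayDeg_pos _ (mem_link.1 hη).2
        (by rw [card_insert_of_mem_link hη, hcard ρ.2]; simp; omega) fun ψ hψ => ?_
      exact (hL ψ hψ).mono ((subset_insert _ _).trans (subset_insert _ _))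
    have ha_ext : ∀ y, B (ext fun ρ => φ ρ - l (X.mark ρ)) y = B φ y := by
      intro y
      refine (hcongr _ _ _ (-l) fun ρ hρ => ?_)
      rcases hρ with hρ | hρ
      · rw [hext0 _ ρ hρ, LinearMap.neg_apply, hl ρ hρ, add_neg_cancel]
      · rw [hext _ ⟨ρ, hρ⟩, LinearMap.neg_apply, sub_eq_add_neg]
    have hz_ext : ∀ y, B (ext fun ρ => z ρ - X.extend z τ (X.mark ρ)) y = B z y := by
      intro y
      refine (hcongr _ _ _ (-X.extend z τ) fun ρ hρ => ?_)
      rcases hρ with hρ | hρ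
      · rw [hext0 _ ρ hρ, LinearMap.neg_apply, hfan.extend_mark hτ z hρ, add_neg_cancel]
      · rw [hext _ ⟨ρ, hρ⟩, LinearMap.neg_apply, sub_eq_add_neg]
    -- The Perron vector a is φ normalised at τ, and w ρ = B(e_ρ, φ) is the degree of φ, φ, L at
    -- `insert ρ τ`; both are positive by convexity.
    have key := Matrix.sum_nonpos_of_bochner
      (b := fun ρ η : X.link τ => B (Pi.single (ρ : ι) 1) (Pi.single (η : ι) 1))
      (a := fun ρ => φ ρ - l (X.mark ρ))
      (w := fun ρ => X.rayDeg ω (insert (ρ : ι) τ) (φ :: φ :: L))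
      (x := fun ρ => z ρ - X.extend z τ (X.mark ρ))
      (fun ρ η => hB.eq _ _) ?_ (fun ρ => sub_pos.2 (hl' ρ ρ.2)) hpos ?_ ?_ ?_ ?_
    · simp only [hBext, hBext2] at key
      rwa [hz_ext, hB.eq, hz_ext] at key
    · intro ρ η hne
      rw [hoff ρ η hne]
      split_ifs with h
      exacts [(hoffpos ρ η h).le, le_rfl]
    · intro ρ
      rw [hBext, ← hB.eq, ha_ext, hB.eq, hsingle ρ.2]
    · intro y hy ρ η
      have := hconn τ hτ (by omega) (ext y) (fun ρ hρ η hη => ?_) ρ ρ.2 η η.2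
      · rwa [hext, hext] at this
      · have hη' := ((mem_link_comm hfan).1 ⟨hρ, hη⟩).2
        have hne : (⟨ρ, hρ⟩ : X.link τ) ≠ ⟨η, hη'⟩ := by
          intro e
          rw [Subtype.mk.injEq] at e
          exact (mem_link.1 hη).1 (e ▸ mem_insert_self _ _)
        have := hy ⟨ρ, hρ⟩ ⟨η, hη'⟩ hne (by
          rw [hoff _ _ hne, if_pos hη]
          exact hoffpos ⟨ρ, hρ⟩ ⟨η, hη'⟩ hη)
        rwa [← hext y, ← hext y] at this
    · intro x
      simp only [hBext, hBext2]
      -- Bochner inequality: with φ moved to the front, B(x,x) is the sum of a ρ times the degree of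
      -- x, x, L at `insert ρ τ`. The induction hypothesis, applied there to x and φ, bounds each
      -- degree by (b x)_ρ² / w ρ.
      rw [hBdef, rayDeg_rotate hfan hbal hτ (by omega),
        rayDeg_cons hfan hbal hτ (by simp; omega) hl, ← sum_coe_sort]
      refine sum_le_sum fun ρ _ => ?_
      have hIH := IsTropical.rayDeg_mul_le hX hconn hbase L (hface ρ.2)
        (by rw [hcard ρ.2]; omega) (fun ψ hψ => (hL' ψ hψ).mono (subset_insert _ _))
        (ext x) φ (hpos ρ)
      rw [hsingle ρ.2, mul_comm, div_mul_eq_mul_div, mul_div_assoc]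
      refine mul_le_mul_of_nonneg_left ?_ (sub_pos.2 (hl' ρ ρ.2)).le
      rwa [le_div_iff₀ (hpos ρ)]
    · rw [← hz, ← hB.eq, ← hz_ext φ, hsum _ _ (hext0 _), ← sum_coe_sort (X.link τ)]
      exact sum_congr rfl fun ρ _ => by rw [hext]

end MarkedCones

/-! ### Criteria for linear independence and for signature. -/

lemma linearIndepOn_of_forall_exists_dual {ι V : Type*} [AddCommGroup V] [Module ℝ V] {u : ι → V}
    {σ : Finset ι}
    (h : ∀ ρ ∈ σ, ∃ l : V →ₗ[ℝ] ℝ, l (u ρ) ≠ 0 ∧ ∀ η ∈ σ, η ≠ ρ → l (u η) = 0) :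
    LinearIndepOn ℝ u (σ : Set ι) := by
  rw [linearIndepOn_finset_iff]
  intro g hg ρ hρ
  obtain ⟨l, h0, hl⟩ := h ρ hρ
  have h1 := congrArg l hg
  rw [map_sum, map_zero, sum_eq_single_of_mem ρ hρ (fun η hη hne => by
    rw [map_smul, hl η hη hne, smul_zero]), map_smul, smul_eq_mul] at h1
  exact (mul_eq_zero.1 h1).resolve_right h0

/-- A form with a positive vector that satisfies the reverse Cauchy–Schwarz inequality has
exactly one positive eigenvalue. -/
lemma sigPos_eq_one_of_mul_le_sq {W : Type*} [AddCommGroup W] [Module ℝ W]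
    [FiniteDimensional ℝ W] {B : LinearMap.BilinForm ℝ W} (hB : B.IsSymm) {e : W}
    (he : 0 < B e e) (h : ∀ x, B x x * B e e ≤ B x e ^ 2) :
    sigPos (LinearMap.BilinMap.toQuadraticMap B) = 1 := by
  have he0 : e ≠ 0 := by
    rintro rfl
    simp at he
  refine le_antisymm ?_ ?_
  -- The form is nonpositive on the kernel of B(e, ·), whose codimension is at most one.
  · have h1 := QuadraticForm.sigPos_add_finrank_le_of_nonpos
      (Q := LinearMap.BilinMap.toQuadraticMap B) (V := LinearMap.ker (B e)) (fun x hx => by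
        have h2 := h x
        rw [show B x e = 0 from (hB.eq e x).symm.trans (LinearMap.mem_ker.1 hx)] at h2
        rw [LinearMap.BilinMap.toQuadraticMap_apply]
        nlinarith)
    have h2 := LinearMap.finrank_range_add_finrank_ker (B e)
    have h3 : Module.finrank ℝ (LinearMap.range (B e)) ≤ 1 :=
      (Submodule.finrank_le _).trans_eq (Module.finrank_self ℝ)
    omega
  · rw [← finrank_span_singleton (K := ℝ) he0]
    refine le_sigPos_of_posDef _ fun ⟨x, hx⟩ hx0 => ?_
    obtain ⟨c, rfl⟩ := Submodule.mem_span_singleton.1 hx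
    have hc : c ≠ 0 := by
      rintro rfl
      simp at hx0
    simp only [QuadraticMap.restrict_apply, LinearMap.BilinMap.toQuadraticMap_apply, map_smul,
      LinearMap.smul_apply, smul_eq_mul]
    have := mul_self_pos.2 hc
    nlinarith [mul_pos this he]

/-! ### Piecewise linear functions, divisors and strict convexity. -/

namespace MarkedCones

variable {ι V : Type*} [DecidableEq ι] [AddCommGroup V] [Module ℝ V]

section Cones

variable {X : MarkedCones ι V} {σ : Finset ι}

lemma mark_mem_cone {ρ : ι} (hρ : ρ ∈ σ) : X.mark ρ ∈ X.cone σ :=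
  Submodule.subset_span ⟨ρ, hρ, rfl⟩

lemma mark_mem_support (hσ : σ ∈ X.faces) {ρ : ι} (hρ : ρ ∈ σ) : X.mark ρ ∈ X.support :=
  ⟨σ, hσ, mark_mem_cone hρ⟩

lemma cone_induction {p : V → Prop} (mem : ∀ ρ ∈ σ, p (X.mark ρ)) (zero : p 0)
    (add : ∀ x y, p x → p y → p (x + y)) (smul : ∀ (a : ℝ) x, 0 ≤ a → p x → p (a • x))
    {x : V} (hx : x ∈ X.cone σ) : p x := by
  induction hx using Submodule.span_induction with
  | mem x h => obtain ⟨ρ, hρ, rfl⟩ := h; exact mem ρ hρ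
  | zero => exact zero
  | add x y _ _ hx hy => exact add x y hx hy
  | smul a x _ hx => exact smul a x a.2 hx

lemma cone_smul_mem {x : V} (hx : x ∈ X.cone σ) {a : ℝ} (ha : 0 ≤ a) : a • x ∈ X.cone σ :=
  Submodule.smul_mem (X.cone σ) (⟨a, ha⟩ : NNReal) hx

lemma eq_zero_of_mem_cone {l : V →ₗ[ℝ] ℝ} (hl : ∀ ρ ∈ σ, l (X.mark ρ) = 0) {x : V}
    (hx : x ∈ X.cone σ) : l x = 0 :=
  cone_induction (p := fun x => l x = 0) hl (map_zero l)
    (fun x y hx hy => by rw [map_add, hx, hy, add_zero])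
    (fun a x _ hx => by rw [map_smul, hx, smul_zero]) hx

lemma linearOn_apply (φ : X.PL) (hσ : σ ∈ X.faces) {x : V} (hx : x ∈ X.cone σ) :
    φ.1 ⟨x, σ, hσ, hx⟩ = X.linearOn φ σ x := by
  rw [linearOn, dif_pos hσ]
  exact (φ.2 σ hσ).choose_spec ⟨x, σ, hσ, hx⟩ hx

open scoped Classical in
/-- The values of a piecewise linear function at the marks. -/
noncomputable def rayVal (X : MarkedCones ι V) : X.PL →ₗ[ℝ] ι → ℝ where
  toFun φ ρ := if h : X.mark ρ ∈ X.support then φ.1 ⟨X.mark ρ, h⟩ else 0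
  map_add' φ ψ := by
    ext ρ
    by_cases h : X.mark ρ ∈ X.support <;> simp [h]
  map_smul' c φ := by
    ext ρ
    by_cases h : X.mark ρ ∈ X.support <;> simp [h]

lemma rayVal_apply (φ : X.PL) {ρ : ι} (h : X.mark ρ ∈ X.support) :
    X.rayVal φ ρ = φ.1 ⟨X.mark ρ, h⟩ := dif_pos h

lemma rayVal_eq_linearOn (φ : X.PL) (hσ : σ ∈ X.faces) {ρ : ι} (hρ : ρ ∈ σ) :
    X.rayVal φ ρ = X.linearOn φ σ (X.mark ρ) := by
  rw [rayVal_apply φ (mark_mem_support hσ hρ), ← linearOn_apply φ hσ (mark_mem_cone hρ)]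

lemma rayVal_restrict (l : V →ₗ[ℝ] ℝ) {ρ : ι} (h : X.mark ρ ∈ X.support) :
    X.rayVal (X.restrict l) ρ = l (X.mark ρ) := rayVal_apply _ h

lemma rayVal_injective : Function.Injective X.rayVal := by
  rw [injective_iff_map_eq_zero]
  intro φ hφ
  ext ⟨x, σ, hσ, hx⟩
  rw [linearOn_apply φ hσ hx]
  refine eq_zero_of_mem_cone (fun ρ hρ => ?_) hx
  rw [← rayVal_eq_linearOn φ hσ hρ, hφ, Pi.zero_apply]

instance [Finite ι] : FiniteDimensional ℝ X.PL :=
  Module.Finite.of_injective X.rayVal rayVal_injective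

/-- The values at the marks of the chosen representative of a divisor. -/
noncomputable def divVal (X : MarkedCones ι V) (D : X.Divisor) : ι → ℝ :=
  X.rayVal (X.rep D)

lemma exists_divVal_eq {φ : X.PL} {D : X.Divisor} (h : X.divisor φ = D) :
    ∃ m : V →ₗ[ℝ] ℝ, ∀ ρ, X.mark ρ ∈ X.support →
      X.divVal D ρ = X.rayVal φ ρ + m (X.mark ρ) := by
  have h1 : (LinearMap.range X.restrict).mkQ (X.rep D) = (LinearMap.range X.restrict).mkQ φ :=
    (Function.surjInv_eq _ D).trans h.symm
  obtain ⟨m, hm⟩ := (Submodule.Quotient.eq _).1 h1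
  refine ⟨m, fun ρ hρ => ?_⟩
  rw [← rayVal_restrict m hρ, hm, map_sub, divVal, Pi.sub_apply]
  ring

lemma divisor_rep (D : X.Divisor) : X.divisor (X.rep D) = D := Function.surjInv_eq _ D

/-- A criterion for strict convexity in terms of the values at the marks. -/
lemma isStrictlyConvex_divisor {φ : X.PL}
    (h : ∀ τ ∈ X.faces, ∃ m : V →ₗ[ℝ] ℝ, (∀ ρ ∈ τ, X.rayVal φ ρ = m (X.mark ρ)) ∧
      ∀ σ ∈ X.faces, τ ⊆ σ → ∀ ρ ∈ σ, ρ ∉ τ → m (X.mark ρ) < X.rayVal φ ρ) :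
    X.IsStrictlyConvex (X.divisor φ) := by
  intro τ hτ
  obtain ⟨m, hm, hm'⟩ := h τ hτ
  have hval : ∀ σ (hσ : σ ∈ X.faces) x (hx : x ∈ X.cone σ),
      (φ - X.restrict m).1 ⟨x, σ, hσ, hx⟩ = (X.linearOn φ σ - m) x := by
    intro σ hσ x hx
    rw [LinearMap.sub_apply, ← linearOn_apply φ hσ hx]
    rfl
  refine ⟨φ - X.restrict m, ?_, ?_, ?_⟩
  · simp only [divisor, map_sub]
    rw [sub_eq_self]
    exact (Submodule.Quotient.mk_eq_zero _).2 ⟨m, rfl⟩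
  · rintro ⟨x, hs⟩ hx
    rw [hval τ hτ x hx]
    refine eq_zero_of_mem_cone (fun ρ hρ => ?_) hx
    rw [LinearMap.sub_apply, ← rayVal_eq_linearOn φ hτ hρ, hm ρ hρ, sub_self]
  · rintro σ hσ hτσ ⟨x, hs⟩ hx hxτ
    rw [hval σ hσ x hx]
    -- Nonnegativity alone is not enough: the second clause records where the function may vanish.
    -- The conjunction is stable under sums and nonnegative multiples, so checking it at the marks
    -- suffices.
    have key : 0 ≤ (X.linearOn φ σ - m) x ∧ ((X.linearOn φ σ - m) x = 0 → x ∈ X.cone τ) := by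
      refine cone_induction (p := fun x => 0 ≤ (X.linearOn φ σ - m) x ∧
        ((X.linearOn φ σ - m) x = 0 → x ∈ X.cone τ)) ?_ ?_ ?_ ?_ hx
      · intro ρ hρ
        rw [LinearMap.sub_apply, ← rayVal_eq_linearOn φ hσ hρ]
        by_cases hρτ : ρ ∈ τ
        · exact ⟨(sub_eq_zero.2 (hm ρ hρτ)).ge, fun _ => mark_mem_cone hρτ⟩
        · have := sub_pos.2 (hm' σ hσ hτσ ρ hρ hρτ)
          exact ⟨this.le, fun h => absurd h this.ne'⟩
      · exact ⟨(map_zero _).ge, fun _ => zero_mem _⟩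
      · rintro x y ⟨hx, hx'⟩ ⟨hy, hy'⟩
        rw [map_add]
        exact ⟨add_nonneg hx hy, fun h => add_mem (hx' (by linarith)) (hy' (by linarith))⟩
      · rintro a x ha ⟨hx, hx'⟩
        rw [map_smul, smul_eq_mul]
        refine ⟨mul_nonneg ha hx, fun h => ?_⟩
        rcases mul_eq_zero.1 h with rfl | h
        · rw [zero_smul]; exact zero_mem _
        · exact cone_smul_mem (hx' h) ha
    exact lt_of_le_of_ne key.1 fun h => hxτ (key.2 h.symm)

/-- A finite family of linear functions none of which changes sign on a cone, and which contains,
for every ray of a cone, a function that vanishes exactly on the other rays of this cone. -/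
structure Separates (X : MarkedCones ι V) {J : Type*} (f : J → V →ₗ[ℝ] ℝ) : Prop where
  sign : ∀ σ ∈ X.faces, ∀ j, (∀ ρ ∈ σ, 0 ≤ f j (X.mark ρ)) ∨ ∀ ρ ∈ σ, f j (X.mark ρ) ≤ 0
  dual : ∀ σ ∈ X.faces, ∀ ρ ∈ σ, ∃ j, f j (X.mark ρ) ≠ 0 ∧ ∀ η ∈ σ, η ≠ ρ → f j (X.mark η) = 0

/-- The sum of the |f j| is linear on each cone because no f j changes sign there. It is strictly
convex because the f j vanishing on τ keep their absolute value after normalisation, and one of them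
is nonzero at each further ray. -/
lemma Separates.isQuasiprojective {J : Type*} [Fintype J] {f : J → V →ₗ[ℝ] ℝ}
    (hf : X.Separates f) : X.IsQuasiprojective := by
  classical
  let φ : X.PL := ⟨fun x => ∑ j, |f j x|, by
    intro σ hσ
    refine ⟨∑ j, (if ∀ ρ ∈ σ, 0 ≤ f j (X.mark ρ) then (1 : ℝ) else -1) • f j, fun x hx => ?_⟩
    rw [LinearMap.sum_apply]
    refine sum_congr rfl fun j _ => ?_
    rw [LinearMap.smul_apply, smul_eq_mul]
    split_ifs with h
    · rw [one_mul, abs_of_nonneg]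
      exact cone_induction (p := fun x => 0 ≤ f j x) h (map_zero _).ge
        (fun x y hx hy => by rw [map_add]; exact add_nonneg hx hy)
        (fun a x ha hx => by rw [map_smul]; exact mul_nonneg ha hx) hx
    · rw [neg_one_mul, abs_of_nonpos]
      exact cone_induction (p := fun x => f j x ≤ 0) ((hf.sign σ hσ j).resolve_left h)
        (map_zero _).le
        (fun x y hx hy => by rw [map_add]; exact add_nonpos hx hy)
        (fun a x ha hx => by
          rw [map_smul]; exact mul_nonpos_of_nonneg_of_nonpos ha hx) hx⟩
  have hφ : ∀ σ ∈ X.faces, ∀ ρ ∈ σ, X.rayVal φ ρ = ∑ j, |f j (X.mark ρ)| :=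
    fun σ hσ ρ hρ => rayVal_apply φ (mark_mem_support hσ hρ)
  refine ⟨X.divisor φ, isStrictlyConvex_divisor fun τ hτ => ?_⟩
  -- The sign of f j on τ, with 0 when f j vanishes on τ; subtracting the sum of c j • f j
  -- normalises the function at τ.
  let c : J → ℝ := fun j => if ∃ ρ ∈ τ, 0 < f j (X.mark ρ) then 1 else
    if ∃ ρ ∈ τ, f j (X.mark ρ) < 0 then -1 else 0
  have hc : ∀ σ ∈ X.faces, τ ⊆ σ → ∀ ρ ∈ σ, ∀ j, c j ≠ 0 →
      c j * f j (X.mark ρ) = |f j (X.mark ρ)| := by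
    intro σ hσ hτσ ρ hρ j hj
    simp only [c] at hj ⊢
    split_ifs at hj ⊢ with h1 h2
    · obtain ⟨η, hη, hpos⟩ := h1
      rcases hf.sign σ hσ j with h | h
      · rw [one_mul, abs_of_nonneg (h ρ hρ)]
      · exact absurd (h η (hτσ hη)) hpos.not_ge
    · obtain ⟨η, hη, hneg⟩ := h2
      rcases hf.sign σ hσ j with h | h
      · exact absurd (h η (hτσ hη)) hneg.not_ge
      · rw [neg_one_mul, abs_of_nonpos (h ρ hρ)]
    · exact absurd rfl hj
  have hc0 : ∀ j, c j = 0 ↔ ∀ ρ ∈ τ, f j (X.mark ρ) = 0 := by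
    intro j
    simp only [c]
    split_ifs with h1 h2
    · obtain ⟨η, hη, hpos⟩ := h1
      exact ⟨fun h => absurd h one_ne_zero, fun h => absurd (h η hη) hpos.ne'⟩
    · obtain ⟨η, hη, hneg⟩ := h2
      exact ⟨fun h => absurd h (by norm_num), fun h => absurd (h η hη) hneg.ne⟩
    · push Not at h1 h2
      exact ⟨fun _ ρ hρ => le_antisymm (h1 ρ hρ) (h2 ρ hρ), fun _ => rfl⟩
  have hm : ∀ ρ, (∑ j, c j • f j) (X.mark ρ) = ∑ j, c j * f j (X.mark ρ) := by
    intro ρ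
    simp [LinearMap.sum_apply]
  refine ⟨∑ j, c j • f j, fun ρ hρ => ?_, fun σ hσ hτσ ρ hρ hρτ => ?_⟩
  · rw [hφ τ hτ ρ hρ, hm]
    refine sum_congr rfl fun j _ => ?_
    by_cases h : c j = 0
    · rw [h, (hc0 j).1 h ρ hρ, abs_zero, mul_zero]
    · exact (hc τ hτ subset_rfl ρ hρ j h).symm
  · rw [hφ σ hσ ρ hρ, hm]
    refine sum_lt_sum (fun j _ => ?_) ?_
    · by_cases h : c j = 0
      · rw [h, zero_mul]; exact abs_nonneg _
      · exact (hc σ hσ hτσ ρ hρ j h).le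
    · obtain ⟨j, hj, hj'⟩ := hf.dual σ hσ ρ hρ
      refine ⟨j, mem_univ _, ?_⟩
      rw [(hc0 j).2 fun η hη => hj' η (hτσ hη) (fun e => hρτ (e ▸ hη)), zero_mul]
      exact abs_pos.2 hj

end Cones

variable {X : MarkedCones ι V} {d k : ℕ} {ω : Finset ι → ℝ} {τ : Finset ι}

/-! ### Stars, and the reduction of the Lorentzian property to mixed degrees of functions on rays.
-/

section Star

lemma mem_star_faces {π : Finset ι} :
    π ∈ (X.star τ).faces ↔ π ∈ X.faces ∧ Disjoint π τ ∧ π ∪ τ ∈ X.faces := by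
  simp [star]

lemma star_mark (ρ : ι) : (X.star τ).mark ρ = (X.coneSpan τ).mkQ (X.mark ρ) := rfl

lemma star_mark_eq_zero {ρ : ι} (hρ : ρ ∈ τ) : (X.star τ).mark ρ = 0 :=
  (Submodule.Quotient.mk_eq_zero _).2 (Submodule.subset_span ⟨ρ, hρ, rfl⟩)

lemma empty_mem_star (hX : X.IsSimplicialFan d) (hτ : τ ∈ X.faces) : ∅ ∈ (X.star τ).faces :=
  mem_star_faces.2 ⟨hX.empty_mem, disjoint_empty_left _, by rwa [empty_union]⟩

lemma link_star (hX : X.IsSimplicialFan d) {π : Finset ι} (hπ : π ∈ (X.star τ).faces) :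
    (X.star τ).link π = X.link (π ∪ τ) := by
  obtain ⟨h1, h2, h3⟩ := mem_star_faces.1 hπ
  ext ρ
  simp only [mem_link, mem_star_faces, mem_union, not_or, disjoint_insert_left, insert_union]
  constructor
  · rintro ⟨hρ, -, ⟨hρτ, -⟩, h⟩
    exact ⟨⟨hρ, hρτ⟩, h⟩
  · rintro ⟨⟨hρ, hρτ⟩, h⟩
    exact ⟨hρ, hX.down_closed _ h _ (insert_subset_insert _ subset_union_left), ⟨hρτ, h2⟩, h⟩

lemma star_mark_mem_support (hX : X.IsSimplicialFan d) (hτ : τ ∈ X.faces) {ρ : ι}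
    (hρ : ρ ∈ τ ∨ ρ ∈ X.link τ) : (X.star τ).mark ρ ∈ (X.star τ).support := by
  have h0 := empty_mem_star hX hτ
  rcases hρ with hρ | hρ
  · rw [star_mark_eq_zero hρ]
    exact ⟨∅, h0, zero_mem _⟩
  · rw [← empty_union τ, ← link_star hX h0, mem_link] at hρ
    exact mark_mem_support hρ.2 (mem_insert_self _ _)

lemma rayVal_star_eq_zero (hX : X.IsSimplicialFan d) (hτ : τ ∈ X.faces) (φ : (X.star τ).PL)
    {ρ : ι} (hρ : ρ ∈ τ) : (X.star τ).rayVal φ ρ = 0 := by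
  have h0 := empty_mem_star hX hτ
  have h1 : (X.star τ).mark ρ ∈ (X.star τ).cone ∅ := by
    rw [star_mark_eq_zero hρ]; exact zero_mem _
  rw [rayVal_apply φ (star_mark_mem_support hX hτ (.inl hρ)), linearOn_apply φ h0 h1,
    star_mark_eq_zero hρ, map_zero]

lemma rayVal_star_eq_linearOn (hX : X.IsSimplicialFan d) (hτ : τ ∈ X.faces) (φ : (X.star τ).PL)
    {π : Finset ι} (hπ : π ∈ (X.star τ).faces) {ρ : ι} (hρ : ρ ∈ π ∪ τ) :
    (X.star τ).rayVal φ ρ =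
      ((X.star τ).linearOn φ π ∘ₗ (X.coneSpan τ).mkQ) (X.mark ρ) := by
  rw [LinearMap.comp_apply, ← star_mark]
  rcases mem_union.1 hρ with h | h
  · exact rayVal_eq_linearOn φ hπ h
  · rw [rayVal_star_eq_zero hX hτ φ h, star_mark_eq_zero h, map_zero]

/-- The pullback of the chosen linear function on the star interpolates the values of the
representative on π ∪ τ, so `rayAct_eq` absorbs the choices made in `rep` and `linearOn`. -/
lemma act_star (hX : X.IsSimplicialFan d) (hτ : τ ∈ X.faces)
    (hω : X.IsMinkowskiWeight (k + 1) ω) {ω' : Finset ι → ℝ} (D : (X.star τ).Divisor)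
    {π : Finset ι} (hπ : π ∈ (X.star τ).faces) (hk : (π ∪ τ).card = k)
    (h : ∀ ρ ∈ X.link (π ∪ τ), ω' (insert ρ π) = ω (insert ρ (π ∪ τ))) :
    (X.star τ).act D ω' π = X.rayAct ((X.star τ).divVal D) ω (π ∪ τ) := by
  rw [rayAct_eq hX hω (mem_star_faces.1 hπ).2.2 hk
    (φ := (X.star τ).divVal D)
    (l := (X.star τ).linearOn ((X.star τ).rep D) π ∘ₗ (X.coneSpan τ).mkQ)
    (fun η hη => (rayVal_star_eq_linearOn hX hτ ((X.star τ).rep D) hπ hη).symm), act, map_sum,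
    ← sum_sub_distrib, link_star hX hπ]
  refine sum_congr rfl fun ρ hρ => ?_
  have hρ' := hρ
  rw [← link_star hX hπ, mem_link] at hρ'
  rw [h ρ hρ, map_smul, map_smul, smul_eq_mul, smul_eq_mul, mul_sub, divVal,
    rayVal_eq_linearOn _ hρ'.2 (mem_insert_self _ _)]
  rfl

lemma foldr_act_star (hX : X.IsSimplicialFan d) (hτ : τ ∈ X.faces) :
    ∀ (L : List (X.star τ).Divisor) {k : ℕ}, X.IsMinkowskiWeight (k + L.length) ω →
      ∀ π ∈ (X.star τ).faces, (π ∪ τ).card = k →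
        L.foldr (X.star τ).act (starWeight ω τ) π =
          X.rayDeg ω (π ∪ τ) (L.map (X.star τ).divVal)
  | [], k, _, π, _, _ => rfl
  | D :: L, k, hω, π, hπ, hk => by
    rw [List.length_cons, add_comm L.length, ← add_assoc] at hω
    refine act_star hX hτ (IsMinkowskiWeight.foldr hX (L.map (X.star τ).divVal)
      (by rwa [List.length_map])) D hπ hk fun ρ hρ => ?_
    rw [← insert_union]
    refine foldr_act_star hX hτ L hω _ ?_ ?_
    · rw [← link_star hX hπ, mem_link] at hρ
      exact hρ.2
    · rw [insert_union, card_insert_of_mem_link hρ, hk]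

lemma deg_star (hX : X.IsSimplicialFan d) (hω : X.IsMinkowskiWeight d ω) (hτ : τ ∈ X.faces)
    (L : List (X.star τ).Divisor) (hL : τ.card + L.length = d) :
    (X.star τ).deg (starWeight ω τ) L = X.rayDeg ω τ (L.map (X.star τ).divVal) := by
  have := foldr_act_star hX hτ L (k := τ.card) (by rwa [hL]) ∅ (empty_mem_star hX hτ)
    (by rw [empty_union])
  rwa [empty_union] at this

/-- For a cone π containing τ, take the representative that vanishes on the cone of π \ τ in the
star. It differs from the chosen one by a linear function, whose pullback supports the values at π.
-/
lemma IsStrictlyConvex.convexAt (hX : X.IsSimplicialFan d) (hτ : τ ∈ X.faces)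
    {D : (X.star τ).Divisor} (hD : (X.star τ).IsStrictlyConvex D) :
    X.ConvexAt τ ((X.star τ).divVal D) := by
  intro π hπ hτπ
  have hu : π \ τ ∪ τ = π := sdiff_union_of_subset hτπ
  have hπ' : π \ τ ∈ (X.star τ).faces :=
    mem_star_faces.2 ⟨hX.down_closed _ hπ _ sdiff_subset, sdiff_disjoint, by rwa [hu]⟩
  obtain ⟨φ, hφ, hφ0, hφpos⟩ := hD _ hπ'
  obtain ⟨m, hm⟩ := exists_divVal_eq hφ
  refine ⟨m ∘ₗ (X.coneSpan τ).mkQ, fun η hη => ?_, fun ρ hρ => ?_⟩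
  · rw [LinearMap.comp_apply, ← star_mark]
    by_cases h : η ∈ τ
    · rw [star_mark_eq_zero h, map_zero, divVal, rayVal_star_eq_zero hX hτ _ h]
    · have hmem := mem_sdiff.2 ⟨hη, h⟩
      have hs := mark_mem_support hπ' hmem
      rw [hm η hs, rayVal_apply φ hs, hφ0 _ (mark_mem_cone hmem), zero_add]
  · rw [LinearMap.comp_apply, ← star_mark]
    have hρπ := (mem_link.1 hρ).1
    have hf : insert ρ (π \ τ) ∈ (X.star τ).faces := by
      rw [← hu, ← link_star hX hπ', mem_link] at hρ
      exact hρ.2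
    have hmem := mark_mem_cone (X := X.star τ) (mem_insert_self ρ (π \ τ))
    have hs := mark_mem_support hf (mem_insert_self ρ (π \ τ))
    rw [hm ρ hs, rayVal_apply φ hs, lt_add_iff_pos_left]
    refine hφpos _ hf (subset_insert _ _) _ hmem fun hcon => ?_
    -- The mark of ρ is not in the cone of π \ τ in the star: the function dual to ρ vanishes on π,
    -- so it descends to the quotient and separates them.
    obtain ⟨l, hl⟩ := hX.exists_linear (mem_link.1 hρ).2 (Pi.single ρ 1)
    have hl0 : ∀ η ∈ π, l (X.mark η) = 0 := fun η hη => by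
      rw [hl η (mem_insert_of_mem hη)]
      exact Pi.single_eq_of_ne (fun (e : η = ρ) => hρπ (e ▸ hη)) _
    have hle : X.coneSpan τ ≤ LinearMap.ker l := fun v hv =>
      eq_zero_of_mem_coneSpan (fun η hη => hl0 η (hτπ hη)) hv
    have h1 := eq_zero_of_mem_cone (X := X.star τ) (l := (X.coneSpan τ).liftQ l hle)
      (fun η hη => hl0 η (mem_sdiff.1 hη).1) hcon
    have h2 : l (X.mark ρ) = 0 := h1
    rw [hl ρ (mem_insert_self _ _), Pi.single_eq_same] at h2
    exact one_ne_zero h2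

/-- Only the functions vanishing on τ descend to the quotient. They still separate, since the
function dual to a ray outside τ vanishes on τ. -/
lemma Separates.star {J : Type*} {f : J → V →ₗ[ℝ] ℝ} (hf : X.Separates f)
    (τ : Finset ι) :
    (X.star τ).Separates (J := {j // X.coneSpan τ ≤ LinearMap.ker (f j)})
      (fun j => (X.coneSpan τ).liftQ (f j) j.2) where
  sign π hπ j := by
    have h := (mem_star_faces.1 hπ).2.2
    exact (hf.sign _ h j.1).imp (fun g ρ hρ => g ρ (mem_union_left _ hρ))
      (fun g ρ hρ => g ρ (mem_union_left _ hρ))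
  dual π hπ ρ hρ := by
    obtain ⟨-, hd, h⟩ := mem_star_faces.1 hπ
    obtain ⟨j, hj, hj'⟩ := hf.dual _ h ρ (mem_union_left _ hρ)
    refine ⟨⟨j, fun v hv => eq_zero_of_mem_coneSpan (fun η hη => ?_) hv⟩, hj, fun η hη hne =>
      hj' η (mem_union_left _ hη) hne⟩
    exact hj' η (mem_union_right _ hη) fun e => disjoint_left.1 hd hρ (e ▸ hη)

end Star

/-- A tropical fan that is quasiprojective by a separating family of linear functions, has
connected stars in dimension at least three and satisfies the reverse Cauchy–Schwarz inequality in
dimension two is Lorentzian. -/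
theorem IsTropical.isLorentzianMarked [Finite ι] (hX : X.IsTropical d ω) {J : Type*} [Finite J]
    {f : J → V →ₗ[ℝ] ℝ} (hf : X.Separates f)
    (hconn : ∀ τ ∈ X.faces, τ.card + 3 ≤ d → ∀ y : ι → ℝ,
      (∀ ρ ∈ X.link τ, ∀ η ∈ X.link (insert ρ τ), y ρ = y η) →
      ∀ ρ ∈ X.link τ, ∀ η ∈ X.link τ, y ρ = y η)
    (hbase : ∀ τ ∈ X.faces, τ.card + 2 = d → ∀ x y : ι → ℝ, 0 < X.rayDeg ω τ [y, y] →
      X.rayDeg ω τ [x, x] * X.rayDeg ω τ [y, y] ≤ X.rayDeg ω τ [x, y] ^ 2) :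
    X.IsLorentzianMarked d ω where
  tropical := hX
  quasiprojective := by
    have := Fintype.ofFinite J
    exact hf.isQuasiprojective
  signature τ hτ L hL hd := by
    have hfan := hX.fan
    have hbal := hX.balanced
    set v := (X.star τ).divVal with hv
    have hL' : ∀ φ ∈ L.map v, X.ConvexAt τ φ := by
      intro φ hφ
      obtain ⟨D, hD, rfl⟩ := List.mem_map.1 hφ
      exact (hL D hD).convexAt hfan hτ
    have hd' : τ.card + 2 + (L.map v).length = d := by rw [List.length_map]; omega
    obtain ⟨B, hB, hBdef⟩ := rayDeg_bilin hfan hbal hτ hd'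
    have hdeg : ∀ D E, (X.star τ).deg (starWeight ω τ) (D :: E :: L) = B (v D) (v E) := by
      intro D E
      rw [hBdef, deg_star hfan hbal hτ _ (by simp; omega)]
      rfl
    -- The map v is not linear, because representatives are chosen. The form is unaffected by linear
    -- functions, so it is nevertheless bilinear on divisors.
    have hcongr : ∀ {φ : (X.star τ).PL} {D} (y : ι → ℝ), (X.star τ).divisor φ = D →
        B (v D) y = B ((X.star τ).rayVal φ) y := by
      intro φ D y h
      obtain ⟨m, hm⟩ := exists_divVal_eq h
      rw [hBdef, hBdef]
      exact rayDeg_congr_head hfan hbal hτ (by simp; omega) (l := m ∘ₗ (X.coneSpan τ).mkQ)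
        (fun ρ hρ => hm ρ (star_mark_mem_support hfan hτ (.inl hρ)))
        (fun ρ hρ => hm ρ (star_mark_mem_support hfan hτ (.inr hρ)))
    have hadd : ∀ D D' y, B (v (D + D')) y = B (v D) y + B (v D') y := by
      intro D D' y
      rw [hcongr (φ := (X.star τ).rep D + (X.star τ).rep D') y (by
        rw [divisor, map_add]
        exact congrArg₂ _ (divisor_rep D) (divisor_rep D')), map_add, map_add]
      rfl
    have hsmul : ∀ (c : ℝ) D y, B (v (c • D)) y = c * B (v D) y := by
      intro c D y
      rw [hcongr (φ := c • (X.star τ).rep D) y (by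
        rw [divisor, map_smul]
        exact congrArg _ (divisor_rep D)), map_smul, map_smul]
      rfl
    have hsymm : ∀ x y, B x y = B y x := fun x y => hB.eq x y
    let C : LinearMap.BilinForm ℝ (X.star τ).Divisor :=
      LinearMap.mk₂ ℝ (fun D E => B (v D) (v E)) (fun D D' E => hadd D D' _)
        (fun c D E => hsmul c D _)
        (fun D E E' => by
          rw [hsymm, hsymm (v D) (v E), hsymm (v D) (v E')]
          exact hadd _ _ _)
        (fun c D E => by
          rw [hsymm, hsymm (v D) (v E)]
          exact hsmul _ _ _)
    have hC : ∀ D E, C D E = B (v D) (v E) := fun _ _ => rfl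
    have hCs : C.IsSymm := ⟨fun D E => hB.eq _ _⟩
    -- A strictly convex divisor on the star gives a vector on which the form is positive.
    obtain ⟨D, hD⟩ : (X.star τ).IsQuasiprojective := by
      have := Fintype.ofFinite {j // X.coneSpan τ ≤ LinearMap.ker (f j)}
      exact (hf.star τ).isQuasiprojective
    have hDc := hD.convexAt hfan hτ
    have hpos : 0 < B (v D) (v D) := by
      rw [hBdef]
      refine hX.rayDeg_pos _ hτ (by simp; omega) fun ψ hψ => ?_
      simp only [List.mem_cons] at hψ
      rcases hψ with rfl | rfl | h
      exacts [hDc, hDc, hL' _ h]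
    refine ⟨C, fun D E => (hdeg D E).symm, hCs, sigPos_eq_one_of_mul_le_sq hCs (e := D) hpos ?_⟩
    intro E
    simp only [hC]
    rw [hBdef] at hpos
    simp only [hBdef]
    exact hX.rayDeg_mul_le hconn hbase _ hτ hd' hL' _ _ hpos

/-! ### Change of marking. -/

section Rescale

variable {c : ι → ℝ}

lemma cone_rescale (hc : ∀ ρ, 0 < c ρ) (σ : Finset ι) : (X.rescale c).cone σ = X.cone σ := by
  apply le_antisymm <;> refine Submodule.span_le.2 ?_ <;> rintro _ ⟨ρ, hρ, rfl⟩
  · exact cone_smul_mem (mark_mem_cone hρ) (hc ρ).le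
  · have h := cone_smul_mem (mark_mem_cone (X := X.rescale c) hρ) (inv_pos.2 (hc ρ)).le
    rwa [rescale, inv_smul_smul₀ (hc ρ).ne'] at h

lemma IsTropical.rescale (hX : X.IsTropical d ω) (hc : ∀ ρ, 0 < c ρ) :
    (X.rescale c).IsTropical d (rescaleWeight c ω) where
  fan :=
    { empty_mem := hX.fan.empty_mem
      indep := fun σ hσ => linearIndepOn_of_forall_exists_dual fun ρ hρ => by
        obtain ⟨l, hl⟩ := hX.fan.exists_linear hσ (Pi.single ρ 1)
        refine ⟨l, ?_, fun η hη hne => ?_⟩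
        · simp [MarkedCones.rescale, hl ρ hρ, (hc ρ).ne']
        · simp [MarkedCones.rescale, hl η hη, hne]
      down_closed := hX.fan.down_closed
      inter := fun σ hσ τ hτ x => by
        simp only [cone_rescale hc]
        exact hX.fan.inter σ hσ τ hτ x
      pure := hX.fan.pure }
  balanced τ hτ hk := by
    have h : ∑ ρ ∈ (X.rescale c).link τ,
        rescaleWeight c ω (insert ρ τ) • (X.rescale c).mark ρ =
        (∏ ρ ∈ τ, (c ρ)⁻¹) • ∑ ρ ∈ X.link τ, ω (insert ρ τ) • X.mark ρ := by
      rw [smul_sum]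
      refine sum_congr rfl fun ρ hρ => ?_
      rw [rescaleWeight, prod_insert (mem_link.1 hρ).1, MarkedCones.rescale, smul_smul, smul_smul]
      congr 1
      have := (hc ρ).ne'
      field_simp
    rw [h]
    refine Submodule.smul_mem _ _ ((Submodule.span_le.2 ?_ : X.coneSpan τ ≤ _)
      (hX.balanced τ hτ hk))
    rintro _ ⟨ρ, hρ, rfl⟩
    have h := Submodule.smul_mem ((X.rescale c).coneSpan τ) (c ρ)⁻¹
      (Submodule.subset_span ⟨ρ, hρ, rfl⟩)
    rwa [MarkedCones.rescale, inv_smul_smul₀ (hc ρ).ne'] at h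
  pos σ hσ hk := mul_pos (prod_pos fun ρ _ => inv_pos.2 (hc ρ)) (hX.pos σ hσ hk)

/-- A function with value φ ρ at c ρ • u_ρ has value φ ρ / c ρ at u_ρ. The extra factor 1 / c ρ in
the weight of `insert ρ τ` accounts for this rescaling. -/
lemma rayAct_rescale (hX : X.IsTropical d ω) (hc : ∀ ρ, 0 < c ρ) {ω₀ ω' : Finset ι → ℝ}
    (hω : X.IsMinkowskiWeight (k + 1) ω₀) (hτ : τ ∈ X.faces) (hk : τ.card = k)
    (h : ∀ ρ ∈ X.link τ, ω' (insert ρ τ) = rescaleWeight c ω₀ (insert ρ τ)) (φ : ι → ℝ) :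
    (X.rescale c).rayAct φ ω' τ = rescaleWeight c (X.rayAct (c⁻¹ * φ) ω₀) τ := by
  have hX' := (hX.rescale hc).fan
  rw [rescaleWeight, rayAct_eq hX.fan hω hτ hk (φ := c⁻¹ * φ) (l := (X.rescale c).extend φ τ),
    rayAct, mul_sum]
  · refine sum_congr rfl fun ρ hρ => ?_
    rw [h ρ hρ, rescaleWeight, prod_insert (mem_link.1 hρ).1, MarkedCones.rescale, map_smul,
      smul_eq_mul, Pi.mul_apply, Pi.inv_apply]
    have := (hc ρ).ne'
    field_simp
  · intro η hη
    have := hX'.extend_mark hτ φ hη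
    rw [MarkedCones.rescale, map_smul, smul_eq_mul] at this
    rw [Pi.mul_apply, Pi.inv_apply, ← this, inv_mul_cancel_left₀ (hc η).ne']
    rfl

lemma rayDeg_rescale (hX : X.IsTropical d ω) (hc : ∀ ρ, 0 < c ρ) :
    ∀ (L : List (ι → ℝ)) {τ : Finset ι}, τ ∈ X.faces → τ.card + L.length = d →
      (X.rescale c).rayDeg (rescaleWeight c ω) τ L =
        (∏ ρ ∈ τ, (c ρ)⁻¹) * X.rayDeg ω τ (L.map (c⁻¹ * ·))
  | [], _, _, _ => rfl
  | φ :: L, τ, hτ, hL => by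
    rw [List.length_cons] at hL
    refine rayAct_rescale hX hc (IsMinkowskiWeight.foldr hX.fan (L.map (c⁻¹ * ·)) (k := τ.card + 1)
      (by rw [List.length_map, add_assoc, add_comm 1, hL]; exact hX.balanced)) hτ rfl
      (fun ρ hρ => ?_) φ
    exact rayDeg_rescale hX hc L (mem_link.1 hρ).2 (by rw [card_insert_of_mem_link hρ]; omega)

lemma Separates.rescale {J : Type*} {f : J → V →ₗ[ℝ] ℝ} (hf : X.Separates f)
    (hc : ∀ ρ, 0 < c ρ) : (X.rescale c).Separates f where
  sign σ hσ j := by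
    refine (hf.sign σ hσ j).imp (fun h ρ hρ => ?_) (fun h ρ hρ => ?_)
    · rw [MarkedCones.rescale, map_smul]
      exact mul_nonneg (hc ρ).le (h ρ hρ)
    · rw [MarkedCones.rescale, map_smul]
      exact mul_nonpos_of_nonneg_of_nonpos (hc ρ).le (h ρ hρ)
  dual σ hσ ρ hρ := by
    obtain ⟨j, hj, hj'⟩ := hf.dual σ hσ ρ hρ
    refine ⟨j, ?_, fun η hη hne => ?_⟩
    · rw [MarkedCones.rescale, map_smul]
      exact mul_ne_zero (hc ρ).ne' hj
    · rw [MarkedCones.rescale, map_smul, hj' η hη hne, smul_zero]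

/-- Rescaling does not change faces or links, so connectedness carries over; in the reverse
Cauchy–Schwarz inequality both sides acquire the square of the same positive factor. -/
theorem IsTropical.isLorentzian [Finite ι] (hX : X.IsTropical d ω) {J : Type*} [Finite J]
    {f : J → V →ₗ[ℝ] ℝ} (hf : X.Separates f)
    (hconn : ∀ τ ∈ X.faces, τ.card + 3 ≤ d → ∀ y : ι → ℝ,
      (∀ ρ ∈ X.link τ, ∀ η ∈ X.link (insert ρ τ), y ρ = y η) →
      ∀ ρ ∈ X.link τ, ∀ η ∈ X.link τ, y ρ = y η)
    (hbase : ∀ τ ∈ X.faces, τ.card + 2 = d → ∀ x y : ι → ℝ, 0 < X.rayDeg ω τ [y, y] →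
      X.rayDeg ω τ [x, x] * X.rayDeg ω τ [y, y] ≤ X.rayDeg ω τ [x, y] ^ 2) :
    X.IsLorentzian d ω := by
  intro c hc
  refine (hX.rescale hc).isLorentzianMarked (hf.rescale hc) hconn fun τ hτ hd x y hy => ?_
  have hp : 0 < ∏ ρ ∈ τ, (c ρ)⁻¹ := prod_pos fun ρ _ => inv_pos.2 (hc ρ)
  have hr : ∀ x y, (X.rescale c).rayDeg (rescaleWeight c ω) τ [x, y] =
      (∏ ρ ∈ τ, (c ρ)⁻¹) * X.rayDeg ω τ [c⁻¹ * x, c⁻¹ * y] :=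
    fun x y => rayDeg_rescale hX hc [x, y] hτ hd
  simp only [hr] at hy ⊢
  have := hbase τ hτ hd (c⁻¹ * x) (c⁻¹ * y) ((mul_pos_iff_of_pos_left hp).1 hy)
  nlinarith [mul_le_mul_of_nonneg_left this (mul_pos hp hp).le]

end Rescale

end MarkedCones

/-! ### Ranks of flats. -/

namespace Matroid

variable {α : Type*} {M : Matroid α}

/-- The rank of a set in a matroid, as a natural number. -/
noncomputable def natRk (M : Matroid α) (X : Set α) : ℕ := (M.eRk X).toNat

section Rank

variable [M.Finite] {F G X Y : Set α} {e : α}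

lemma coe_natRk (X : Set α) : (M.natRk X : ℕ∞) = M.eRk X :=
  ENat.natCast_toNat (M.eRk_ne_top_iff.2 (M.isRkFinite_set X))

lemma natRk_mono (h : X ⊆ Y) : M.natRk X ≤ M.natRk Y := by
  rw [← Nat.cast_le (α := ℕ∞), coe_natRk, coe_natRk]
  exact M.eRk_mono h

lemma natRk_closure (X : Set α) : M.natRk (M.closure X) = M.natRk X := by
  rw [natRk, eRk_closure_eq, natRk]

lemma natRk_inter_add_natRk_union_le (X Y : Set α) :
    M.natRk (X ∩ Y) + M.natRk (X ∪ Y) ≤ M.natRk X + M.natRk Y := by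
  rw [← Nat.cast_le (α := ℕ∞)]
  push_cast
  simp only [coe_natRk]
  exact M.eRk_inter_add_eRk_union_le X Y

lemma IsFlat.eq_of_subset_of_natRk_le (hF : M.IsFlat F) (hG : M.IsFlat G) (h : F ⊆ G)
    (hr : M.natRk G ≤ M.natRk F) : F = G := by
  rw [← Nat.cast_le (α := ℕ∞), coe_natRk, coe_natRk] at hr
  rw [← hF.closure, ← hG.closure]
  exact (M.isRkFinite_set F).closure_eq_closure_of_subset_of_eRk_ge_eRk h hr

lemma IsFlat.natRk_insert (hF : M.IsFlat F) (he : e ∈ M.E) (heF : e ∉ F) :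
    M.natRk (insert e F) = M.natRk F + 1 := by
  rw [← Nat.cast_inj (R := ℕ∞)]
  push_cast
  rw [coe_natRk, coe_natRk, eRk_insert_eq_add_one]
  rw [hF.closure]
  exact ⟨he, heF⟩

/-- Adding an element of G outside H and taking the closure raises the rank by exactly one and stays
inside G. -/
lemma IsFlat.exists_between (hF : M.IsFlat F) (hG : M.IsFlat G) (h : F ⊆ G) {r : ℕ}
    (hr : M.natRk F ≤ r) (hr' : r ≤ M.natRk G) :
    ∃ H, M.IsFlat H ∧ F ⊆ H ∧ H ⊆ G ∧ M.natRk H = r := by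
  induction r, hr using Nat.le_induction with
  | base => exact ⟨F, hF, subset_rfl, h, rfl⟩
  | succ r hr ih =>
    obtain ⟨H, hH, hFH, hHG, rfl⟩ := ih (by omega)
    have hne : ¬ G ⊆ H := fun hGH => by have := natRk_mono (M := M) hGH; omega
    obtain ⟨e, heG, heH⟩ := Set.not_subset.1 hne
    have heE := hG.subset_ground heG
    refine ⟨M.closure (insert e H), M.isFlat_closure _, hFH.trans ((Set.subset_insert e H).trans
      (M.subset_closure _ (Set.insert_subset heE hH.subset_ground))), ?_, ?_⟩
    · rw [← hG.closure]
      exact M.closure_subset_closure (Set.insert_subset heG hHG)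
    · rw [natRk_closure, hH.natRk_insert heE heH]

variable [M.Loopless]

lemma isFlat_empty : M.IsFlat ∅ := by
  rw [isFlat_iff_closure_eq]
  exact M.loops_eq_empty

lemma natRk_empty : M.natRk ∅ = 0 := by simp [natRk]

lemma natRk_ground {d : ℕ} (hd : M.eRank = d + 1) : M.natRk M.E = d + 1 := by
  rw [natRk, eRk_ground, hd]
  rfl

namespace ProperFlat

/-- The rank of a nonempty proper flat. -/
noncomputable def rk (F : M.ProperFlat) : ℕ := M.natRk F.1

variable {F G : M.ProperFlat}

lemma rk_mono (h : F ≤ G) : F.rk ≤ G.rk := natRk_mono h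

lemma eq_of_le_of_rk_le (h : F ≤ G) (hr : G.rk ≤ F.rk) : F = G :=
  Subtype.ext (F.2.1.eq_of_subset_of_natRk_le G.2.1 h hr)

lemma le_of_rk_lt (h : F ≤ G ∨ G ≤ F) (hr : F.rk < G.rk) : F ≤ G :=
  h.resolve_right fun h => (rk_mono h).not_gt hr

lemma eq_of_rk_eq (h : F ≤ G ∨ G ≤ F) (hr : F.rk = G.rk) : F = G :=
  h.elim (fun h => eq_of_le_of_rk_le h hr.ge) (fun h => (eq_of_le_of_rk_le h hr.le).symm)

lemma rk_pos (F : M.ProperFlat) : 0 < F.rk := by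
  by_contra h
  have := isFlat_empty.eq_of_subset_of_natRk_le F.2.1 (Set.empty_subset _)
    (by rw [natRk_empty]; exact not_lt.1 h)
  exact F.2.2.1.ne_empty this.symm

lemma rk_le {d : ℕ} (hd : M.eRank = d + 1) (F : M.ProperFlat) : F.rk ≤ d := by
  by_contra h
  refine F.2.2.2 (F.2.1.eq_of_subset_of_natRk_le M.ground_isFlat F.2.1.subset_ground ?_)
  rw [natRk_ground hd]
  exact not_le.1 h

end ProperFlat

/-- A flat of intermediate rank is nonempty and proper. -/
lemma IsFlat.proper {d : ℕ} (hd : M.eRank = d + 1) (hF : M.IsFlat F) (h0 : 0 < M.natRk F)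
    (h1 : M.natRk F ≤ d) : M.IsFlat F ∧ F.Nonempty ∧ F ≠ M.E := by
  refine ⟨hF, ?_, ?_⟩
  · rw [Set.nonempty_iff_ne_empty]
    rintro rfl
    simp [natRk] at h0
  · rintro rfl
    rw [natRk_ground hd] at h1
    omega

end Rank

/-! ### Flags of flats and the ranks they miss. -/

section Chains

variable [M.Finite] [M.Loopless] {d : ℕ} {σ τ : Finset M.ProperFlat}

lemma mem_bergmanFan_faces :
    σ ∈ M.bergmanFan.faces ↔ ∀ F ∈ σ, ∀ G ∈ σ, F ≤ G ∨ G ≤ F := by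
  rw [bergmanFan, Set.Finite.mem_toFinset, Set.mem_ofPred_eq]
  constructor
  · intro h F hF G hG
    exact h.total hF hG
  · exact fun h F hF G hG _ => h F hF G hG

lemma insert_mem_bergmanFan_faces (hσ : σ ∈ M.bergmanFan.faces) {F : M.ProperFlat}
    (hF : ∀ G ∈ σ, F ≤ G ∨ G ≤ F) : insert F σ ∈ M.bergmanFan.faces := by
  rw [mem_bergmanFan_faces] at hσ ⊢
  intro G hG H hH
  rcases Finset.mem_insert.1 hG with rfl | hG' <;> rcases Finset.mem_insert.1 hH with rfl | hH'
  exacts [.inl le_rfl, hF H hH', (hF G hG').symm, hσ G hG' H hH']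

lemma mem_bergmanFan_link (hσ : σ ∈ M.bergmanFan.faces) {F : M.ProperFlat} :
    F ∈ M.bergmanFan.link σ ↔ F ∉ σ ∧ ∀ G ∈ σ, F ≤ G ∨ G ≤ F := by
  rw [MarkedCones.mem_link]
  refine and_congr_right fun _ => ⟨fun h G hG => ?_, insert_mem_bergmanFan_faces hσ⟩
  exact mem_bergmanFan_faces.1 h F (mem_insert_self _ _) G (mem_insert_of_mem hG)

lemma rk_injOn (hσ : σ ∈ M.bergmanFan.faces) :
    Set.InjOn (ProperFlat.rk : M.ProperFlat → ℕ) σ := fun F hF G hG h =>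
  ProperFlat.eq_of_rk_eq (mem_bergmanFan_faces.1 hσ F hF G hG) h

/-- L is the neighbour of rank r from below in the flag, with ∅ (a flat, by looplessness) added as
bottom; `exists_upper` is the dual statement with the ground set as top. -/
lemma exists_lower (hσ : σ ∈ M.bergmanFan.faces) {r : ℕ} (hr : 0 < r) :
    ∃ L, M.IsFlat L ∧ (L = ∅ ∨ ∃ F ∈ σ, F.1 = L) ∧ (∀ F ∈ σ, F.rk < r → F.1 ⊆ L) ∧
      M.natRk L < r := by
  rcases (σ.filter fun F => F.rk < r).eq_empty_or_nonempty with h | h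
  · refine ⟨∅, isFlat_empty, .inl rfl, fun F hF hFr => ?_, by rwa [natRk_empty]⟩
    exact absurd (mem_filter.2 ⟨hF, hFr⟩) (h ▸ notMem_empty F)
  · obtain ⟨F, hF, hmax⟩ := exists_max_image _ ProperFlat.rk h
    rw [mem_filter] at hF
    refine ⟨F.1, F.2.1, .inr ⟨F, hF.1, rfl⟩, fun G hG hGr => ?_, hF.2⟩
    have h1 := hmax G (mem_filter.2 ⟨hG, hGr⟩)
    rcases mem_bergmanFan_faces.1 hσ G hG F hF.1 with h | h
    · exact h
    · exact (ProperFlat.eq_of_le_of_rk_le h h1).ge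

lemma exists_upper (hd : M.eRank = d + 1) (hσ : σ ∈ M.bergmanFan.faces) {r : ℕ} (hr : r ≤ d) :
    ∃ U, M.IsFlat U ∧ (U = M.E ∨ ∃ F ∈ σ, F.1 = U) ∧ (∀ F ∈ σ, r < F.rk → U ⊆ F.1) ∧
      r < M.natRk U := by
  rcases (σ.filter fun F => r < F.rk).eq_empty_or_nonempty with h | h
  · refine ⟨M.E, M.ground_isFlat, .inl rfl, fun F hF hFr => ?_, ?_⟩
    · exact absurd (mem_filter.2 ⟨hF, hFr⟩) (h ▸ notMem_empty F)
    · rw [natRk_ground hd]; omega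
  · obtain ⟨F, hF, hmin⟩ := exists_min_image _ ProperFlat.rk h
    rw [mem_filter] at hF
    refine ⟨F.1, F.2.1, .inr ⟨F, hF.1, rfl⟩, fun G hG hGr => ?_, hF.2⟩
    have h1 := hmin G (mem_filter.2 ⟨hG, hGr⟩)
    rcases mem_bergmanFan_faces.1 hσ G hG F hF.1 with h | h
    · exact (ProperFlat.eq_of_le_of_rk_le h h1).ge
    · exact h

/-- If rank r is missing, a flat of rank r between the two neighbours L and U in the flag is
comparable with all members. This gives purity of the fan. -/
lemma exists_rk_eq (hd : M.eRank = d + 1) (hσ : σ ∈ M.bergmanFan.faces) {r : ℕ} (hr : 0 < r)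
    (hrd : r ≤ d) : ∃ H : M.ProperFlat, H.rk = r ∧ ∀ F ∈ σ, H ≤ F ∨ F ≤ H := by
  by_cases h : ∃ H ∈ σ, H.rk = r
  · obtain ⟨H, hH, hHr⟩ := h
    exact ⟨H, hHr, mem_bergmanFan_faces.1 hσ H hH⟩
  · push Not at h
    obtain ⟨L, hL, hL1, hL2, hL3⟩ := exists_lower hσ hr
    obtain ⟨U, hU, hU1, hU2, hU3⟩ := exists_upper hd hσ hrd
    have hLU : L ⊆ U := by
      rcases hL1 with rfl | ⟨F, hF, rfl⟩
      · exact Set.empty_subset _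
      · rcases hU1 with rfl | ⟨G, hG, rfl⟩
        · exact hL.subset_ground
        · exact ProperFlat.le_of_rk_lt (mem_bergmanFan_faces.1 hσ F hF G hG) (hL3.trans hU3)
    obtain ⟨H, hH, hLH, hHU, hHr⟩ := hL.exists_between hU hLU hL3.le hU3.le
    refine ⟨⟨H, hH.proper hd (by omega) (by omega)⟩, hHr, fun F hF => ?_⟩
    rcases lt_or_gt_of_ne (h F hF) with h | h
    · exact .inr ((hL2 F hF h).trans hLH)
    · exact .inl (hHU.trans (hU2 F hF h))

lemma rk_mapsTo (hd : M.eRank = d + 1) (σ : Finset M.ProperFlat) :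
    ∀ F ∈ σ, F.rk ∈ Finset.Icc 1 d :=
  fun F _ => Finset.mem_Icc.2 ⟨F.rk_pos, F.rk_le hd⟩

/-- The ranks that are not attained in a flag. -/
lemma card_missing (hd : M.eRank = d + 1) (hσ : σ ∈ M.bergmanFan.faces) :
    (Finset.Icc 1 d \ σ.image ProperFlat.rk).card + σ.card = d := by
  have h1 : σ.image ProperFlat.rk ⊆ Finset.Icc 1 d := by
    intro r hr
    obtain ⟨F, hF, rfl⟩ := mem_image.1 hr
    exact rk_mapsTo hd σ F hF
  rw [← card_image_of_injOn (rk_injOn hσ), card_sdiff_add_card_eq_card h1, Nat.card_Icc]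
  omega

lemma mem_missing {r : ℕ} : r ∈ Finset.Icc 1 d \ σ.image ProperFlat.rk ↔
    (0 < r ∧ r ≤ d) ∧ ∀ F ∈ σ, F.rk ≠ r := by
  simp [Nat.one_le_iff_ne_zero, Nat.pos_iff_ne_zero]

/-- A flat `G` that is comparable with all members of a flag is separated from its other members
by a pair of elements. -/
lemma exists_separating (hd : M.eRank = d + 1) (hσ : σ ∈ M.bergmanFan.faces) {G : M.ProperFlat}
    (hG : ∀ F ∈ σ, G ≤ F ∨ F ≤ G) : ∃ e e' : M.E, (e : α) ∈ G.1 ∧ (e' : α) ∉ G.1 ∧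
      ∀ F ∈ σ, F ≠ G → ((e : α) ∈ F.1 ↔ (e' : α) ∈ F.1) := by
  obtain ⟨L, hL, hL1, hL2, hL3⟩ := exists_lower hσ G.rk_pos
  obtain ⟨U, hU, hU1, hU2, hU3⟩ := exists_upper hd hσ (G.rk_le hd)
  obtain ⟨e, heG, heL⟩ := Set.not_subset.1 fun h : G.1 ⊆ L =>
    (natRk_mono (M := M) h).not_gt hL3
  obtain ⟨e', heU, heG'⟩ := Set.not_subset.1 fun h : U ⊆ G.1 =>
    (natRk_mono (M := M) h).not_gt hU3
  refine ⟨⟨e, G.2.1.subset_ground heG⟩, ⟨e', hU.subset_ground heU⟩, heG, heG', fun F hF hne => ?_⟩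
  have hrk : F.rk ≠ G.rk := fun h => hne (ProperFlat.eq_of_rk_eq (hG F hF).symm h)
  rcases lt_or_gt_of_ne hrk with h | h
  · exact iff_of_false (fun h' => heL (hL2 F hF h h'))
      fun h' => heG' (ProperFlat.le_of_rk_lt (hG F hF).symm h h')
  · exact iff_of_true (ProperFlat.le_of_rk_lt (hG F hF) h heG) (hU2 F hF h heU)

/-- The join of two flats of the same rank `r` that cover a common flat of a flag. -/
lemma exists_join (hd : M.eRank = d + 1) (hσ : σ ∈ M.bergmanFan.faces) {r : ℕ} (hrd : r < d)
    (hr : ∀ F ∈ σ, F.rk ≠ r) (hlow : ∀ s, 0 < s → s < r → ∃ F ∈ σ, F.rk = s)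
    {G H : M.ProperFlat} (hG : ∀ F ∈ σ, G ≤ F ∨ F ≤ G) (hH : ∀ F ∈ σ, H ≤ F ∨ F ≤ H)
    (hGr : G.rk = r) (hHr : H.rk = r) (hne : G ≠ H) :
    ∃ J : M.ProperFlat, J.rk = r + 1 ∧ G ≤ J ∧ H ≤ J ∧ (∀ K, G ≤ K → H ≤ K → J ≤ K) ∧
      ∀ F ∈ σ, J ≤ F ∨ F ≤ J := by
  have hr0 : 0 < r := hGr ▸ G.rk_pos
  obtain ⟨L, hL, hL1, hL2, hL3⟩ := exists_lower hσ hr0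
  -- Every positive rank below r occurs in the flag, so L has rank at least r - 1.
  have hLr : r ≤ M.natRk L + 1 := by
    rcases Nat.lt_or_ge 1 r with h | h
    · obtain ⟨F, hF, hFr⟩ := hlow (r - 1) (by omega) (by omega)
      have : F.rk ≤ M.natRk L := natRk_mono (hL2 F hF (by omega))
      omega
    · omega
  have hLe : ∀ K : M.ProperFlat, (∀ F ∈ σ, K ≤ F ∨ F ≤ K) → K.rk = r → L ⊆ K.1 := by
    intro K hK hKr
    rcases hL1 with rfl | ⟨F, hF, rfl⟩
    · exact Set.empty_subset _
    · exact ProperFlat.le_of_rk_lt (hK F hF).symm (hL3.trans_eq hKr.symm)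
  have hGJ : G.1 ⊆ M.closure (G.1 ∪ H.1) := M.subset_closure_of_subset' Set.subset_union_left
    G.2.1.subset_ground
  have hHJ : H.1 ⊆ M.closure (G.1 ∪ H.1) := M.subset_closure_of_subset' Set.subset_union_right
    H.2.1.subset_ground
  have hmin : ∀ K : M.ProperFlat, G ≤ K → H ≤ K → M.closure (G.1 ∪ H.1) ⊆ K.1 := by
    intro K hGK hHK
    rw [← K.2.1.closure]
    exact M.closure_subset_closure (Set.union_subset hGK hHK)
  -- Submodularity with L ⊆ G ∩ H bounds the rank by r + 1. If it were at most r, both G and H would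
  -- equal the closure.
  have hJr : M.natRk (M.closure (G.1 ∪ H.1)) = r + 1 := by
    apply le_antisymm
    · have h1 := natRk_inter_add_natRk_union_le (M := M) G.1 H.1
      have h2 := natRk_mono (M := M) (Set.subset_inter (hLe G hG hGr) (hLe H hH hHr))
      change _ ≤ G.rk + H.rk at h1
      rw [natRk_closure]
      omega
    · by_contra hcon
      have h1 := G.2.1.eq_of_subset_of_natRk_le (M.isFlat_closure _) hGJ
        (by change _ ≤ G.rk; omega)
      have h2 := H.2.1.eq_of_subset_of_natRk_le (M.isFlat_closure _) hHJ
        (by change _ ≤ H.rk; omega)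
      exact hne (Subtype.ext (h1.trans h2.symm))
  refine ⟨⟨_, (M.isFlat_closure (G.1 ∪ H.1)).proper hd (by omega) (by omega)⟩, hJr, hGJ, hHJ,
    hmin, fun F hF => ?_⟩
  rcases lt_or_gt_of_ne (hr F hF) with h | h
  · exact .inr ((ProperFlat.le_of_rk_lt (hG F hF).symm (by omega) : F ≤ G).trans hGJ)
  · exact .inl (hmin F (ProperFlat.le_of_rk_lt (hG F hF) (by omega))
      (ProperFlat.le_of_rk_lt (hH F hF) (by omega)))

end Chains

end Matroid

/-! ### Points of a cone as nonnegative combinations. -/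

namespace MarkedCones

variable {ι V : Type*} [AddCommGroup V] [Module ℝ V] {X : MarkedCones ι V} {σ : Finset ι}

lemma mem_cone_iff {x : V} : x ∈ X.cone σ ↔
    ∃ a : ι → ℝ, (∀ ρ, 0 ≤ a ρ) ∧ x = ∑ ρ ∈ σ, a ρ • X.mark ρ := by
  classical
  constructor
  · intro hx
    refine cone_induction (p := fun x => ∃ a : ι → ℝ, (∀ ρ, 0 ≤ a ρ) ∧
      x = ∑ ρ ∈ σ, a ρ • X.mark ρ) ?_ ?_ ?_ ?_ hx
    · intro ρ hρ
      refine ⟨Pi.single ρ 1, fun η => ?_, ?_⟩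
      · by_cases h : η = ρ
        · subst h; simp
        · simp [h]
      · rw [sum_eq_single_of_mem ρ hρ fun η _ hne => by simp [hne]]
        simp
    · exact ⟨0, fun _ => le_rfl, by simp⟩
    · rintro x y ⟨a, ha, rfl⟩ ⟨b, hb, rfl⟩
      exact ⟨a + b, fun ρ => add_nonneg (ha ρ) (hb ρ), by
        simp [add_smul, sum_add_distrib]⟩
    · rintro c x hc ⟨a, ha, rfl⟩
      exact ⟨c • a, fun ρ => mul_nonneg hc (ha ρ), by simp [smul_sum, mul_smul]⟩
  · rintro ⟨a, ha, rfl⟩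
    exact sum_mem fun ρ hρ => cone_smul_mem (mark_mem_cone hρ) (ha ρ)

end MarkedCones

/-! ### The Bergman fan is a tropical fan. -/

namespace Matroid

variable {α : Type*} {M : Matroid α}

section Marks

/-- The class of the indicator vector of a set. -/
noncomputable def indicatorVec (M : Matroid α) (A : Set α) : M.BergmanSpace :=
  Submodule.Quotient.mk (fun e => A.indicator (fun _ => (1 : ℝ)) e)

lemma indicatorVec_empty : M.indicatorVec ∅ = 0 := by
  rw [indicatorVec, Submodule.Quotient.mk_eq_zero]
  simp only [Set.indicator_empty]
  exact Submodule.zero_mem _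

lemma indicatorVec_ground : M.indicatorVec M.E = 0 := by
  rw [indicatorVec, Submodule.Quotient.mk_eq_zero]
  have : (fun e : M.E => M.E.indicator (fun _ => (1 : ℝ)) e) = fun _ => 1 := by
    ext e
    simp
  rw [this]
  exact Submodule.mem_span_singleton_self _

/-- The difference of two coordinates, as a linear function on the Bergman space. -/
noncomputable def coordDiff (M : Matroid α) (p : M.E × M.E) : M.BergmanSpace →ₗ[ℝ] ℝ :=
  Submodule.liftQ _ (LinearMap.proj (R := ℝ) (φ := fun _ : M.E => ℝ) p.1 -
    LinearMap.proj (R := ℝ) (φ := fun _ : M.E => ℝ) p.2) (by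
    rw [Submodule.span_le]
    rintro _ rfl
    exact sub_self (1 : ℝ))

lemma coordDiff_mk (p : M.E × M.E) (v : M.E → ℝ) :
    M.coordDiff p (Submodule.Quotient.mk v) = v p.1 - v p.2 := by
  rw [coordDiff, Submodule.liftQ_apply]
  rfl

open scoped Classical in
lemma coordDiff_indicatorVec (p : M.E × M.E) (A : Set α) :
    M.coordDiff p (M.indicatorVec A) =
      (if (p.1 : α) ∈ A then 1 else 0) - if (p.2 : α) ∈ A then 1 else 0 := by
  rw [indicatorVec, coordDiff_mk, Set.indicator_apply, Set.indicator_apply]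

end Marks

variable [M.Finite] [M.Loopless] {d : ℕ} {σ τ : Finset M.ProperFlat}

lemma bergmanFan_mark (F : M.ProperFlat) : M.bergmanFan.mark F = M.indicatorVec F.1 := rfl

instance : Finite M.E := M.ground_finite.to_subtype

/-- Members of a flag are nested, so they cannot separate a pair of elements in both directions: the
difference of the two coordinates has one sign. The dual functions come from `exists_separating`. -/
lemma separates_coordDiff (hd : M.eRank = d + 1) : M.bergmanFan.Separates M.coordDiff where
  sign σ hσ p := by
    classical
    simp only [bergmanFan_mark, coordDiff_indicatorVec]
    by_cases h : ∃ F ∈ σ, (p.1 : α) ∈ F.1 ∧ (p.2 : α) ∉ F.1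
    · left
      obtain ⟨F, hF, h1, h2⟩ := h
      intro G hG
      have : (p.2 : α) ∈ G.1 → (p.1 : α) ∈ G.1 := fun h => by
        rcases mem_bergmanFan_faces.1 hσ F hF G hG with hFG | hGF
        · exact hFG h1
        · exact absurd (hGF h) h2
      split_ifs <;> simp_all
    · right
      push Not at h
      intro G hG
      have := h G hG
      split_ifs <;> simp_all
  dual σ hσ G hG := by
    classical
    obtain ⟨e, e', he, he', h⟩ := exists_separating hd hσ (mem_bergmanFan_faces.1 hσ G hG)
    refine ⟨(e, e'), ?_, fun F hF hne => ?_⟩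
    · rw [bergmanFan_mark, coordDiff_indicatorVec, if_pos he, if_neg he']
      norm_num
    · rw [bergmanFan_mark, coordDiff_indicatorVec, sub_eq_zero]
      exact if_congr (h F hF hne) rfl rfl

lemma down_closed_bergmanFan (hσ : σ ∈ M.bergmanFan.faces) (h : τ ⊆ σ) :
    τ ∈ M.bergmanFan.faces := by
  rw [mem_bergmanFan_faces] at hσ ⊢
  exact fun F hF G hG => hσ F (h hF) G (h hG)

/-- The differences of coordinates of a point detect the flats that carry it. This shows that cones
intersect in common faces. -/
lemma mem_of_mem_cones (hd : M.eRank = d + 1) (hσ : σ ∈ M.bergmanFan.faces)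
    (hτ : τ ∈ M.bergmanFan.faces) {a b : M.ProperFlat → ℝ} (ha : ∀ F, 0 ≤ a F)
    (hb : ∀ F, 0 ≤ b F)
    (hab : ∑ F ∈ σ, a F • M.bergmanFan.mark F = ∑ F ∈ τ, b F • M.bergmanFan.mark F)
    {G : M.ProperFlat} (hG : G ∈ σ) (hpos : 0 < a G) : G ∈ τ := by
  classical
  have key : ∀ (σ : Finset M.ProperFlat) (a : M.ProperFlat → ℝ), σ ∈ M.bergmanFan.faces →
      (∀ F, 0 ≤ a F) → ∀ G ∈ σ, 0 < a G → ∀ p : M.E × M.E, (p.1 : α) ∈ G.1 → (p.2 : α) ∉ G.1 →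
      0 < M.coordDiff p (∑ F ∈ σ, a F • M.bergmanFan.mark F) := by
    intro σ a hσ ha G hG hpos p h1 h2
    have hGp : M.coordDiff p (M.bergmanFan.mark G) = 1 := by
      rw [bergmanFan_mark, coordDiff_indicatorVec, if_pos h1, if_neg h2, sub_zero]
    rw [map_sum]
    refine sum_pos' (fun F hF => ?_) ⟨G, hG, ?_⟩
    · rw [map_smul]
      refine mul_nonneg (ha F) ?_
      rcases (separates_coordDiff hd).sign σ hσ p with h | h
      · exact h F hF
      · have := h G hG
        rw [hGp] at this
        norm_num at this
    · rw [map_smul, hGp, smul_eq_mul, mul_one]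
      exact hpos
  by_contra hGτ
  set τ' := τ.filter fun F => 0 < b F with hτ'
  have hτ'f : τ' ∈ M.bergmanFan.faces := down_closed_bergmanFan hτ (filter_subset _ _)
  -- If G and F were incomparable, elements of G \ F and F \ G would give a coordinate difference
  -- that is both positive and negative.
  have hcomp : ∀ F ∈ τ', G ≤ F ∨ F ≤ G := by
    intro F hF
    rw [hτ', mem_filter] at hF
    by_contra hcon
    rw [not_or] at hcon
    obtain ⟨e, he, he'⟩ := Set.not_subset.1 hcon.1
    obtain ⟨f, hf, hf'⟩ := Set.not_subset.1 hcon.2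
    have h1 := key σ a hσ ha G hG hpos
      (⟨e, G.2.1.subset_ground he⟩, ⟨f, F.2.1.subset_ground hf⟩) he hf'
    have h2 := key τ b hτ hb F hF.1 hF.2
      (⟨f, F.2.1.subset_ground hf⟩, ⟨e, G.2.1.subset_ground he⟩) hf he'
    rw [← hab] at h2
    have h3 : ∀ (e f : M.E) v, M.coordDiff (f, e) v = -M.coordDiff (e, f) v := by
      intro e f v
      obtain ⟨v, rfl⟩ := Submodule.Quotient.mk_surjective _ v
      rw [coordDiff_mk, coordDiff_mk, neg_sub]
    rw [h3] at h2
    exact lt_asymm h1 (neg_pos.1 h2)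
  -- As G is not in τ', the pair e, e' is separated by G but by no member of τ', so the coordinate
  -- difference is both positive and zero.
  obtain ⟨e, e', he, he', h⟩ := exists_separating hd hτ'f hcomp
  have h1 := key σ a hσ ha G hG hpos (e, e') he he'
  rw [hab, map_sum] at h1
  refine h1.ne' (sum_eq_zero fun F hF => ?_)
  rw [map_smul]
  rcases (hb F).eq_or_lt with h0 | h0
  · rw [← h0, zero_smul]
  · rw [bergmanFan_mark, coordDiff_indicatorVec, smul_eq_mul, mul_eq_zero, sub_eq_zero]
    exact .inr (if_congr (h F (mem_filter.2 ⟨hF, h0⟩) fun e => hGτ (e ▸ hF)) rfl rfl)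

theorem isSimplicialFan_bergmanFan (hd : M.eRank = d + 1) : M.bergmanFan.IsSimplicialFan d where
  empty_mem := mem_bergmanFan_faces.2 (by simp)
  indep σ hσ := linearIndepOn_of_forall_exists_dual fun G hG => by
    obtain ⟨p, hp⟩ := (separates_coordDiff hd).dual σ hσ G hG
    exact ⟨_, hp⟩
  down_closed σ hσ τ h := down_closed_bergmanFan hσ h
  inter σ hσ τ hτ x hxσ hxτ := by
    obtain ⟨a, ha, rfl⟩ := MarkedCones.mem_cone_iff.1 hxσ
    obtain ⟨b, hb, hab⟩ := MarkedCones.mem_cone_iff.1 hxτ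
    refine MarkedCones.mem_cone_iff.2 ⟨a, ha, (sum_subset inter_subset_left ?_).symm⟩
    intro F hF hF'
    rcases (ha F).eq_or_lt with h | h
    · rw [← h, zero_smul]
    · exact absurd (mem_inter.2 ⟨hF, mem_of_mem_cones hd hσ hτ ha hb hab hF h⟩) hF'
  pure σ hσ := by
    have h := card_missing hd hσ.1
    suffices h0 : Finset.Icc 1 d \ σ.image ProperFlat.rk = ∅ by
      rwa [h0, card_empty, zero_add] at h
    rw [eq_empty_iff_forall_notMem]
    intro r hr
    obtain ⟨⟨hr0, hrd⟩, hr⟩ := mem_missing.1 hr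
    obtain ⟨H, hH, hcomp⟩ := exists_rk_eq hd hσ.1 hr0 hrd
    exact hr H (hσ.2 (insert_mem_bergmanFan_faces hσ.1 hcomp) (subset_insert _ _)
      (mem_insert_self _ _)) hH

/-- The flats that extend a flag missing a single rank. -/
lemma sum_link_mark (hd : M.eRank = d + 1) (hσ : σ ∈ M.bergmanFan.faces) {t : ℕ} (ht0 : 0 < t)
    (htd : t ≤ d) (ht : ∀ F ∈ σ, F.rk ≠ t)
    (hall : ∀ s, 0 < s → s ≤ d → s ≠ t → ∃ F ∈ σ, F.rk = s) :
    ∑ H ∈ M.bergmanFan.link σ, M.bergmanFan.mark H =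
      ∑ F ∈ σ.filter (fun F => F.rk = t + 1), M.bergmanFan.mark F +
        (((M.bergmanFan.link σ).card : ℝ) - 1) •
          ∑ F ∈ σ.filter (fun F => F.rk + 1 = t), M.bergmanFan.mark F := by
  classical
  obtain ⟨L, hL, hL1, hL2, hL3⟩ := exists_lower hσ ht0
  obtain ⟨U, hU, hU1, hU2, hU3⟩ := exists_upper hd hσ htd
  have hLt : M.natRk L + 1 = t := by
    refine le_antisymm hL3 ?_
    by_contra hcon
    obtain ⟨F, hF, hFr⟩ := hall (t - 1) (by omega) (by omega) (by omega)
    have : F.rk ≤ M.natRk L := natRk_mono (hL2 F hF (by omega))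
    omega
  have hUt : M.natRk U = t + 1 := by
    refine le_antisymm ?_ hU3
    by_contra hcon
    rcases hU1 with rfl | ⟨F, hF, rfl⟩
    · rw [natRk_ground hd] at hcon
      obtain ⟨G, hG, hGr⟩ := hall (t + 1) (by omega) (by omega) (by omega)
      have := natRk_mono (M := M) (hU2 G hG (by omega))
      rw [natRk_ground hd] at this
      change _ ≤ G.rk at this
      omega
    · have h1 := F.rk_le hd
      change ¬ F.rk ≤ t + 1 at hcon
      obtain ⟨G, hG, hGr⟩ := hall (t + 1) (by omega) (by omega) (by omega)
      have : F.rk ≤ G.rk := natRk_mono (M := M) (hU2 G hG (by omega))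
      omega
  -- The filtered sum has at most one term; it is empty exactly when the neighbour is ∅, whose class
  -- is zero. The same holds above, where the class of the ground set is zero.
  have hLsum : ∑ F ∈ σ.filter (fun F => F.rk + 1 = t), M.bergmanFan.mark F =
      M.indicatorVec L := by
    rcases hL1 with rfl | ⟨F, hF, rfl⟩
    · rw [indicatorVec_empty, sum_eq_zero]
      intro F hF
      rw [mem_filter] at hF
      exact absurd (Set.subset_empty_iff.1 (hL2 F hF.1 (by omega))) F.2.2.1.ne_empty
    · rw [sum_eq_single_of_mem F (mem_filter.2 ⟨hF, hLt⟩), bergmanFan_mark]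
      intro G hG hne
      rw [mem_filter] at hG
      exact absurd (rk_injOn hσ hG.1 hF (by change _ = M.natRk F.1; omega)) hne
  have hUsum : ∑ F ∈ σ.filter (fun F => F.rk = t + 1), M.bergmanFan.mark F =
      M.indicatorVec U := by
    rcases hU1 with rfl | ⟨F, hF, rfl⟩
    · rw [indicatorVec_ground, sum_eq_zero]
      intro F hF
      rw [mem_filter] at hF
      exact absurd (F.2.1.subset_ground.antisymm (hU2 F hF.1 (by omega))) F.2.2.2
    · rw [sum_eq_single_of_mem F (mem_filter.2 ⟨hF, hUt⟩), bergmanFan_mark]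
      intro G hG hne
      rw [mem_filter] at hG
      exact absurd (rk_injOn hσ hG.1 hF (by change _ = M.natRk F.1; omega)) hne
  have hlink : ∀ H, H ∈ M.bergmanFan.link σ ↔ H.rk = t ∧ L ⊆ H.1 ∧ H.1 ⊆ U := by
    intro H
    rw [mem_bergmanFan_link hσ]
    constructor
    · rintro ⟨hHσ, hH⟩
      have hHt : H.rk = t := by
        by_contra hne
        obtain ⟨F, hF, hFr⟩ := hall H.rk H.rk_pos (H.rk_le hd) hne
        exact hHσ (ProperFlat.eq_of_rk_eq (hH F hF) hFr.symm ▸ hF)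
      refine ⟨hHt, ?_, ?_⟩
      · rcases hL1 with rfl | ⟨F, hF, rfl⟩
        · exact Set.empty_subset _
        · exact ProperFlat.le_of_rk_lt (hH F hF).symm (hL3.trans_eq hHt.symm)
      · rcases hU1 with rfl | ⟨F, hF, rfl⟩
        · exact H.2.1.subset_ground
        · exact ProperFlat.le_of_rk_lt (hH F hF) (hHt.trans_lt hU3)
    · rintro ⟨hHt, hLH, hHU⟩
      refine ⟨fun h => ht H h hHt, fun F hF => ?_⟩
      rcases lt_or_gt_of_ne (ht F hF) with h | h
      · exact .inr ((hL2 F hF h).trans hLH)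
      · exact .inl (hHU.trans (hU2 F hF h))
  have hLU : L ⊆ U := by
    obtain ⟨H, hH, hcomp⟩ := exists_rk_eq hd hσ ht0 htd
    have := (hlink H).1 ((mem_bergmanFan_link hσ).2 ⟨fun h => ht H h hH, hcomp⟩)
    exact this.2.1.trans this.2.2
  rw [hLsum, hUsum]
  simp only [bergmanFan_mark, indicatorVec]
  rw [← Submodule.Quotient.mk_smul, ← Submodule.Quotient.mk_add]
  refine (map_sum (Submodule.mkQ _) _ _).symm.trans (congrArg Submodule.Quotient.mk ?_)
  ext e
  simp only [Finset.sum_apply, Pi.add_apply, Pi.smul_apply, smul_eq_mul, Set.indicator_apply]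
  -- The sets H \ L partition U \ L: an element of L lies in every H of the link, one of U \ L in
  -- exactly one H (the closure of L and this element), and one outside U in none.
  by_cases heL : (e : α) ∈ L
  · rw [if_pos heL, if_pos (hLU heL), sum_congr rfl fun H hH => if_pos (((hlink H).1 hH).2.1 heL)]
    simp
  rw [if_neg heL, mul_zero, add_zero]
  by_cases heU : (e : α) ∈ U
  · rw [if_pos heU]
    have hK : M.natRk (M.closure (insert (e : α) L)) = t := by
      rw [natRk_closure, hL.natRk_insert e.2 heL, hLt]
    have hsub : insert (e : α) L ⊆ M.closure (insert (e : α) L) :=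
      M.subset_closure _ (Set.insert_subset e.2 hL.subset_ground)
    let K : M.ProperFlat := ⟨M.closure (insert (e : α) L),
      (M.isFlat_closure _).proper hd (by omega) (by omega)⟩
    have hmin : ∀ G, M.IsFlat G → L ⊆ G → (e : α) ∈ G → K.1 ⊆ G := by
      intro G hG hLG heG
      rw [← hG.closure]
      exact M.closure_subset_closure (Set.insert_subset heG hLG)
    have hKl : K ∈ M.bergmanFan.link σ :=
      (hlink K).2 ⟨hK, (Set.subset_insert _ _).trans hsub, hmin U hU hLU heU⟩
    rw [sum_eq_single_of_mem K hKl, if_pos (hsub (Set.mem_insert _ _))]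
    intro H hH hne
    refine if_neg fun heH => hne ?_
    obtain ⟨h1, h2, h3⟩ := (hlink H).1 hH
    exact (ProperFlat.eq_of_le_of_rk_le (hmin H.1 H.2.1 h2 heH : K ≤ H)
      (h1.trans hK.symm).le).symm
  · rw [if_neg heU]
    exact sum_eq_zero fun H hH => if_neg fun heH => heU (((hlink H).1 hH).2.2 heH)

/-- A flag with one element less than a maximal one misses exactly one rank. -/
lemma exists_missing_rank (hd : M.eRank = d + 1) (hσ : σ ∈ M.bergmanFan.faces)
    (hc : σ.card + 1 = d) : ∃ t, 0 < t ∧ t ≤ d ∧ (∀ F ∈ σ, F.rk ≠ t) ∧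
      ∀ s, 0 < s → s ≤ d → s ≠ t → ∃ F ∈ σ, F.rk = s := by
  obtain ⟨t, ht⟩ := card_eq_one.1 (show (Finset.Icc 1 d \ σ.image ProperFlat.rk).card = 1 by
    have := card_missing hd hσ; omega)
  have h1 : ∀ s, s = t ↔ (0 < s ∧ s ≤ d) ∧ ∀ F ∈ σ, F.rk ≠ s := by
    intro s
    rw [← mem_missing, ht, mem_singleton]
  obtain ⟨⟨h2, h3⟩, h4⟩ := (h1 t).1 rfl
  refine ⟨t, h2, h3, h4, fun s hs0 hsd hst => ?_⟩
  by_contra hcon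
  push Not at hcon
  exact hst ((h1 s).2 ⟨⟨hs0, hsd⟩, hcon⟩)

theorem isTropical_bergmanFan (hd : M.eRank = d + 1) :
    M.bergmanFan.IsTropical d (fun _ => 1) where
  fan := isSimplicialFan_bergmanFan hd
  balanced σ hσ hc := by
    obtain ⟨t, ht0, htd, ht, hall⟩ := exists_missing_rank hd hσ hc
    simp only [one_smul]
    rw [sum_link_mark hd hσ ht0 htd ht hall]
    exact add_mem (sum_mem fun F hF => Submodule.subset_span ⟨F, (mem_filter.1 hF).1, rfl⟩)
      (Submodule.smul_mem _ _
        (sum_mem fun F hF => Submodule.subset_span ⟨F, (mem_filter.1 hF).1, rfl⟩))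
  pos _ _ _ := one_pos

/-- Degrees on the one-dimensional stars of the Bergman fan. -/
lemma rayDeg_singleton (hd : M.eRank = d + 1) (hσ : σ ∈ M.bergmanFan.faces)
    (hc : σ.card + 1 = d) {t : ℕ} (ht0 : 0 < t) (htd : t ≤ d) (ht : ∀ F ∈ σ, F.rk ≠ t)
    (hall : ∀ s, 0 < s → s ≤ d → s ≠ t → ∃ F ∈ σ, F.rk = s) (z : M.ProperFlat → ℝ) :
    M.bergmanFan.rayDeg (fun _ => 1) σ [z] = ∑ H ∈ M.bergmanFan.link σ, z H -
      (∑ F ∈ σ.filter (fun F => F.rk = t + 1), z F +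
        (((M.bergmanFan.link σ).card : ℝ) - 1) *
          ∑ F ∈ σ.filter (fun F => F.rk + 1 = t), z F) := by
  have hX := isTropical_bergmanFan hd
  -- A linear function interpolating z on σ, applied to the relation between the marks, evaluates
  -- the correction term.
  obtain ⟨l, hl⟩ := hX.fan.exists_linear hσ z
  have h1 := congrArg l (sum_link_mark hd hσ ht0 htd ht hall)
  rw [map_add, map_smul, map_sum, map_sum, map_sum, smul_eq_mul,
    sum_congr (g := z) rfl fun F hF => hl F (mem_filter.1 hF).1,
    sum_congr (s₁ := σ.filter (fun F => F.rk + 1 = t)) (g := z) rfl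
      fun F hF => hl F (mem_filter.1 hF).1] at h1
  rw [← h1, MarkedCones.rayDeg_cons hX.fan hX.balanced hσ (by simpa using hc) hl,
    ← sum_sub_distrib]
  exact sum_congr rfl fun H _ => one_mul _

end Matroid

/-! ### The degree form of a rank three geometric lattice. -/

/-- The quadratic form of a rank three geometric lattice with points `R` and lines `S` is a square
minus a sum of squares. -/
lemma Finset.incidence_form_eq {ι : Type*} {R S : Finset ι} {a : ι → ι → ℝ}
    (ha : ∀ H K, a H K * a H K = a H K)
    (hone : ∀ H ∈ R, ∀ H' ∈ R, H ≠ H' → ∑ K ∈ S, a H K * a H' K = 1) (z : ι → ℝ) :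
    ∑ H ∈ R, (∑ K ∈ S, a H K * z K - (∑ K ∈ S, a H K - 1) * z H) * z H +
      ∑ K ∈ S, (∑ H ∈ R, a H K * z H - z K) * z K =
    (∑ H ∈ R, z H) ^ 2 - ∑ K ∈ S, (z K - ∑ H ∈ R, a H K * z H) ^ 2 := by
  classical
  have h1 : ∑ K ∈ S, (∑ H ∈ R, a H K * z H) ^ 2 =
      ∑ H ∈ R, ∑ H' ∈ R, z H * z H' * ∑ K ∈ S, a H K * a H' K := by
    have h : ∀ K, (∑ H ∈ R, a H K * z H) ^ 2 =
        ∑ H ∈ R, ∑ H' ∈ R, z H * z H' * (a H K * a H' K) := by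
      intro K
      rw [sq, sum_mul_sum]
      exact sum_congr rfl fun H _ => sum_congr rfl fun H' _ => by ring
    simp only [h, mul_sum]
    rw [sum_comm]
    exact sum_congr rfl fun H _ => sum_comm
  -- Distinct points share one line, so off the diagonal each product is counted once; on the
  -- diagonal it is counted as often as there are lines through H.
  have h2 : ∑ H ∈ R, ∑ H' ∈ R, z H * z H' * ∑ K ∈ S, a H K * a H' K =
      (∑ H ∈ R, z H) ^ 2 + ∑ H ∈ R, (∑ K ∈ S, a H K - 1) * z H * z H := by
    rw [sq, sum_mul_sum, ← sum_add_distrib]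
    refine sum_congr rfl fun H hH => ?_
    rw [← add_sum_erase _ _ hH, ← add_sum_erase R (fun H' => z H * z H') hH,
      sum_congr rfl fun K _ => ha H K, sum_congr (s₁ := R.erase H) (g := fun H' => z H * z H') rfl fun H' hH' => by
        rw [hone H hH H' (mem_of_mem_erase hH') (ne_of_mem_erase hH').symm, mul_one]]
    ring
  have h3 : ∑ H ∈ R, (∑ K ∈ S, a H K * z K) * z H = ∑ K ∈ S, z K * ∑ H ∈ R, a H K * z H := by
    simp only [sum_mul, mul_sum]
    rw [sum_comm]
    exact sum_congr rfl fun K _ => sum_congr rfl fun H _ => by ring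
  have h4 : ∑ K ∈ S, (z K - ∑ H ∈ R, a H K * z H) ^ 2 = ∑ K ∈ S, z K ^ 2 -
      2 * ∑ K ∈ S, z K * ∑ H ∈ R, a H K * z H + ∑ K ∈ S, (∑ H ∈ R, a H K * z H) ^ 2 := by
    rw [mul_sum, ← sum_sub_distrib, ← sum_add_distrib]
    exact sum_congr rfl fun K _ => by ring
  have h5 : ∑ K ∈ S, (∑ H ∈ R, a H K * z H - z K) * z K =
      ∑ K ∈ S, z K * ∑ H ∈ R, a H K * z H - ∑ K ∈ S, z K ^ 2 := by
    rw [← sum_sub_distrib]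
    exact sum_congr rfl fun K _ => by ring
  have h6 : ∑ H ∈ R, (∑ K ∈ S, a H K * z K - (∑ K ∈ S, a H K - 1) * z H) * z H =
      ∑ H ∈ R, (∑ K ∈ S, a H K * z K) * z H - ∑ H ∈ R, (∑ K ∈ S, a H K - 1) * z H * z H := by
    rw [← sum_sub_distrib]
    exact sum_congr rfl fun H _ => by ring
  rw [h6, h5, h4, h1, h2, h3]
  ring

/-! ### Connectedness and two-dimensional stars of the Bergman fan. -/

namespace Matroid

variable {α : Type*} {M : Matroid α} [M.Finite] [M.Loopless] {d : ℕ} {τ : Finset M.ProperFlat}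

lemma rk_ne_of_mem_link (hτ : τ ∈ M.bergmanFan.faces) {H : M.ProperFlat}
    (hH : H ∈ M.bergmanFan.link τ) : ∀ F ∈ τ, F.rk ≠ H.rk := fun F hF h => by
  rw [mem_bergmanFan_link hτ] at hH
  exact hH.1 (ProperFlat.eq_of_rk_eq (hH.2 F hF) h.symm ▸ hF)

lemma mem_link_of_rk_ne (hτ : τ ∈ M.bergmanFan.faces) {H : M.ProperFlat}
    (hH : ∀ F ∈ τ, H ≤ F ∨ F ≤ H) (h : ∀ F ∈ τ, F.rk ≠ H.rk) : H ∈ M.bergmanFan.link τ :=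
  (mem_bergmanFan_link hτ).2 ⟨fun hm => h H hm rfl, hH⟩

lemma mem_link_insert (hτ : τ ∈ M.bergmanFan.faces) {H K : M.ProperFlat}
    (hH : H ∈ M.bergmanFan.link τ) :
    K ∈ M.bergmanFan.link (insert H τ) ↔ K ∈ M.bergmanFan.link τ ∧ K ≠ H ∧ (K ≤ H ∨ H ≤ K) := by
  have hτ' := (MarkedCones.mem_link.1 hH).2
  rw [mem_bergmanFan_link hτ', mem_bergmanFan_link hτ]
  simp only [Finset.mem_insert, not_or, forall_eq_or_imp]
  tauto

/-- The stars of the Bergman fan of dimension at least three are connected. -/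
lemma bergmanFan_connected (hd : M.eRank = d + 1) (hτ : τ ∈ M.bergmanFan.faces)
    (hc : τ.card + 3 ≤ d) (y : M.ProperFlat → ℝ)
    (hy : ∀ F ∈ M.bergmanFan.link τ, ∀ G ∈ M.bergmanFan.link (insert F τ), y F = y G) :
    ∀ F ∈ M.bergmanFan.link τ, ∀ G ∈ M.bergmanFan.link τ, y F = y G := by
  set T := Finset.Icc 1 d \ τ.image ProperFlat.rk with hT
  have hTc : 3 ≤ T.card := by
    have := card_missing hd hτ
    rw [← hT] at this
    omega
  have hTne : T.Nonempty := card_pos.1 (by omega)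
  obtain ⟨r, hrT, hrmin⟩ : ∃ r ∈ T, ∀ s ∈ T, r ≤ s := ⟨T.min' hTne, T.min'_mem _, T.min'_le⟩
  -- At least three ranks are missing, so one exceeds the least one by two or more. A flat of rank s
  -- comparable with a join of rank r + 1 then lies above it.
  obtain ⟨s, hsT, hrs⟩ : ∃ s ∈ T, r + 2 ≤ s := by
    by_contra hcon
    push Not at hcon
    have h1 : T ⊆ {r, r + 1} := fun s hs => by
      have h1 := hrmin s hs
      have h2 := hcon s hs
      simp only [Finset.mem_insert, mem_singleton]
      omega
    have h2 := (card_le_card h1).trans card_le_two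
    omega
  obtain ⟨⟨hr0, hrd⟩, hr⟩ := mem_missing.1 hrT
  obtain ⟨⟨hs0, hsd⟩, hs⟩ := mem_missing.1 hsT
  have hadj : ∀ {F G}, F ∈ M.bergmanFan.link τ → G ∈ M.bergmanFan.link τ → G ≤ F ∨ F ≤ G →
      y F = y G := by
    intro F G hF hG h
    by_cases hne : G = F
    · rw [hne]
    · exact hy F hF G ((mem_link_insert hτ hF).2 ⟨hG, hne, h⟩)
  -- Every flat of the link is adjacent or equal to one of the least missing rank r, so it remains
  -- to connect those.
  have hstep : ∀ F ∈ M.bergmanFan.link τ, ∃ G ∈ M.bergmanFan.link τ, G.rk = r ∧ y F = y G := by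
    intro F hF
    obtain ⟨G, hGr, hG⟩ := exists_rk_eq hd (MarkedCones.mem_link.1 hF).2 hr0 hrd
    have hGl : G ∈ M.bergmanFan.link τ := mem_link_of_rk_ne hτ
      (fun F' hF' => hG F' (mem_insert_of_mem hF')) (by rwa [hGr])
    exact ⟨G, hGl, hGr, hadj hF hGl (hG F (mem_insert_self _ _))⟩
  have hmain : ∀ G ∈ M.bergmanFan.link τ, G.rk = r → ∀ H ∈ M.bergmanFan.link τ, H.rk = r →
      y G = y H := by
    intro G hG hGr H hH hHr
    by_cases hne : G = H
    · rw [hne]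
    obtain ⟨J, hJr, hGJ, hHJ, -, hJ⟩ := exists_join hd hτ (by omega) hr
      (fun s hs0 hsr => by
        by_contra hcon
        push Not at hcon
        exact (hrmin s (mem_missing.2 ⟨⟨hs0, by omega⟩, hcon⟩)).not_gt hsr)
      ((mem_bergmanFan_link hτ).1 hG).2 ((mem_bergmanFan_link hτ).1 hH).2 hGr hHr hne
    -- A flat of the missing rank s above the join J is a common neighbour of G and H; J itself need
    -- not belong to the link.
    obtain ⟨K, hKs, hK⟩ := exists_rk_eq hd (insert_mem_bergmanFan_faces hτ hJ) hs0 hsd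
    have hJK : J ≤ K := ProperFlat.le_of_rk_lt (hK J (mem_insert_self _ _)).symm (by omega)
    have hKl : K ∈ M.bergmanFan.link τ := mem_link_of_rk_ne hτ
      (fun F hF => hK F (mem_insert_of_mem hF)) (by rwa [hKs])
    exact (hadj hG hKl (.inr (hGJ.trans hJK))).trans (hadj hH hKl (.inr (hHJ.trans hJK))).symm
  intro F hF G hG
  obtain ⟨F', hF', hFr, hFF⟩ := hstep F hF
  obtain ⟨G', hG', hGr, hGG⟩ := hstep G hG
  rw [hFF, hGG, hmain F' hF' hFr G' hG' hGr]

lemma exists_missing_ranks (hd : M.eRank = d + 1) (hτ : τ ∈ M.bergmanFan.faces)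
    (hc : τ.card + 2 = d) : ∃ r s, 0 < r ∧ r < s ∧ s ≤ d ∧ (∀ F ∈ τ, F.rk ≠ r) ∧
      (∀ F ∈ τ, F.rk ≠ s) ∧ ∀ t, 0 < t → t ≤ d → t ≠ r → t ≠ s → ∃ F ∈ τ, F.rk = t := by
  obtain ⟨r, s, hne, hT⟩ := card_eq_two.1
    (show (Finset.Icc 1 d \ τ.image ProperFlat.rk).card = 2 by
      have := card_missing hd hτ; omega)
  have h1 : ∀ t, (t = r ∨ t = s) ↔ (0 < t ∧ t ≤ d) ∧ ∀ F ∈ τ, F.rk ≠ t := by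
    intro t
    rw [← mem_missing, hT, Finset.mem_insert, mem_singleton]
  have hr := (h1 r).1 (.inl rfl)
  have hs := (h1 s).1 (.inr rfl)
  have hall : ∀ t, 0 < t → t ≤ d → t ≠ r → t ≠ s → ∃ F ∈ τ, F.rk = t := by
    intro t ht0 htd htr hts
    by_contra hcon
    push Not at hcon
    exact ((h1 t).2 ⟨⟨ht0, htd⟩, hcon⟩).elim htr hts
  rcases lt_or_gt_of_ne hne with h | h
  · exact ⟨r, s, hr.1.1, h, hs.1.2, hr.2, hs.2, hall⟩
  · exact ⟨s, r, hs.1.1, h, hr.1.2, hs.2, hr.2, fun t h1 h2 h3 h4 => hall t h1 h2 h4 h3⟩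

/-- The degree form of a two-dimensional star of the Bergman fan is negative semidefinite on a
hyperplane. -/
lemma exists_rayDeg_nonpos (hd : M.eRank = d + 1) (hτ : τ ∈ M.bergmanFan.faces)
    (hc : τ.card + 2 = d) : ∃ R : Finset M.ProperFlat, ∀ z : M.ProperFlat → ℝ,
      (∀ F ∈ τ, z F = 0) → ∑ H ∈ R, z H = 0 →
        M.bergmanFan.rayDeg (fun _ => 1) τ [z, z] ≤ 0 := by
  classical
  obtain ⟨r, s, hr0, hrs, hsd, hr, hs, hall⟩ := exists_missing_ranks hd hτ hc
  set R := (M.bergmanFan.link τ).filter fun H => H.rk = r with hR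
  set S := (M.bergmanFan.link τ).filter fun H => ¬ H.rk = r with hS
  have hX := isTropical_bergmanFan hd
  have hRmem : ∀ H, H ∈ R ↔ H ∈ M.bergmanFan.link τ ∧ H.rk = r := fun H => mem_filter
  have hSmem : ∀ H, H ∈ S ↔ H ∈ M.bergmanFan.link τ ∧ H.rk = s := by
    intro H
    rw [hS, mem_filter]
    refine and_congr_right fun hH => ⟨fun hne => ?_, fun h => by omega⟩
    by_contra hne'
    obtain ⟨F, hF, hFr⟩ := hall H.rk H.rk_pos (H.rk_le hd) hne hne'
    exact rk_ne_of_mem_link hτ hH F hF hFr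
  set a : M.ProperFlat → M.ProperFlat → ℝ := fun H K => if H ≤ K then 1 else 0 with ha
  have hlinkR : ∀ H ∈ R, M.bergmanFan.link (insert H τ) = S.filter (H ≤ ·) := by
    intro H hH
    rw [hRmem] at hH
    ext K
    rw [mem_link_insert hτ hH.1, mem_filter, hSmem]
    constructor
    · rintro ⟨h1, h2, h3⟩
      have hK : K ∈ S := mem_filter.2 ⟨h1, fun h => h2 (ProperFlat.eq_of_rk_eq h3 (h.trans hH.2.symm))⟩
      rw [hSmem] at hK
      exact ⟨hK, ProperFlat.le_of_rk_lt h3.symm (by omega)⟩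
    · rintro ⟨⟨h1, h2⟩, h3⟩
      exact ⟨h1, fun h => by rw [h] at h2; omega, .inr h3⟩
  have hlinkS : ∀ K ∈ S, M.bergmanFan.link (insert K τ) = R.filter (· ≤ K) := by
    intro K hK
    rw [hSmem] at hK
    ext H
    rw [mem_link_insert hτ hK.1, mem_filter, hRmem]
    constructor
    · rintro ⟨h1, h2, h3⟩
      have hH : H.rk = r := by
        by_contra hne
        have := (hSmem H).1 (mem_filter.2 ⟨h1, hne⟩)
        exact h2 (ProperFlat.eq_of_rk_eq h3 (this.2.trans hK.2.symm))
      exact ⟨⟨h1, hH⟩, ProperFlat.le_of_rk_lt h3 (by omega)⟩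
    · rintro ⟨⟨h1, h2⟩, h3⟩
      exact ⟨h1, fun h => by rw [h] at h2; omega, .inl h3⟩
  have hface : ∀ {H}, H ∈ M.bergmanFan.link τ → insert H τ ∈ M.bergmanFan.faces :=
    fun h => (MarkedCones.mem_link.1 h).2
  have hcard : ∀ {H}, H ∈ M.bergmanFan.link τ → (insert H τ).card + 1 = d := fun h => by
    rw [MarkedCones.card_insert_of_mem_link h]; omega
  refine ⟨R, fun z hz hz0 => ?_⟩
  have hsum : ∀ (H : M.ProperFlat) (p : M.ProperFlat → Prop) [DecidablePred p],
      H ∈ M.bergmanFan.link τ →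
      ∑ F ∈ (insert H τ).filter p, z F = if p H then z H else 0 := by
    intro H p _ hH
    rw [sum_filter, sum_insert (MarkedCones.mem_link.1 hH).1, sum_eq_zero, add_zero]
    intro F hF
    rw [hz F hF, ite_self]
  -- The flag `insert H τ` misses only the rank s. As z vanishes on τ, the correction terms see only
  -- H, which has rank s - 1 exactly when r + 1 = s.
  have hdegR : ∀ H ∈ R, M.bergmanFan.rayDeg (fun _ => 1) (insert H τ) [z] =
      ∑ K ∈ S, a H K * z K - (∑ K ∈ S, a H K - 1) * if r + 1 = s then z H else 0 := by
    intro H hH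
    have hH' := (hRmem H).1 hH
    rw [rayDeg_singleton hd (hface hH'.1) (hcard hH'.1) (hr0.trans hrs) hsd, hsum _ _ hH'.1,
      hsum _ _ hH'.1, if_neg (by omega), hlinkR H hH, hH'.2, zero_add, sum_filter, card_filter]
    · simp [ha]
    · intro F hF
      rcases Finset.mem_insert.1 hF with rfl | hF
      · omega
      · exact hs F hF
    · intro t ht0 htd hts
      by_cases htr : t = r
      · exact ⟨H, mem_insert_self _ _, hH'.2.trans htr.symm⟩
      · obtain ⟨F, hF, hFt⟩ := hall t ht0 htd htr hts
        exact ⟨F, mem_insert_of_mem hF, hFt⟩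
  have hdegS : ∀ K ∈ S, M.bergmanFan.rayDeg (fun _ => 1) (insert K τ) [z] =
      ∑ H ∈ R, a H K * z H - if r + 1 = s then z K else 0 := by
    intro K hK
    have hK' := (hSmem K).1 hK
    rw [rayDeg_singleton hd (hface hK'.1) (hcard hK'.1) hr0 (hrs.le.trans hsd), hsum _ _ hK'.1,
      hsum _ _ hK'.1, if_neg (by omega : ¬ K.rk + 1 = r), hlinkS K hK, hK'.2, mul_zero, add_zero,
      sum_filter]
    · simp [ha, eq_comm]
    · intro F hF
      rcases Finset.mem_insert.1 hF with rfl | hF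
      · omega
      · exact hr F hF
    · intro t ht0 htd htr
      by_cases hts : t = s
      · exact ⟨K, mem_insert_self _ _, hK'.2.trans hts.symm⟩
      · obtain ⟨F, hF, hFt⟩ := hall t ht0 htd htr hts
        exact ⟨F, mem_insert_of_mem hF, hFt⟩
  rw [MarkedCones.rayDeg_cons_of_vanish hX.fan hX.balanced hτ (by simp; omega) hz,
    ← sum_filter_add_sum_filter_not _ (fun H => H.rk = r),
    sum_congr rfl fun H hH => by rw [hdegR H hH],
    sum_congr (s₁ := (M.bergmanFan.link τ).filter fun H => ¬ H.rk = r) rfl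
      fun K hK => by rw [hdegS K hK]]
  -- For consecutive missing ranks the star is that of a rank three lattice with points R and lines
  -- S. The square of the sum over R vanishes, leaving minus a sum of squares.
  by_cases h : r + 1 = s
  · simp only [if_pos h]
    rw [incidence_form_eq (R := R) (S := S) (fun H K => by simp [ha]), hz0]
    · have : 0 ≤ ∑ K ∈ S, (z K - ∑ H ∈ R, a H K * z H) ^ 2 := sum_nonneg fun _ _ => sq_nonneg _
      linarith
    · intro H hH H' hH' hne
      rw [hRmem] at hH hH'
      obtain ⟨J, hJr, hGJ, hHJ, hmin, hJ⟩ := exists_join hd hτ (by omega) hr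
        (fun t ht0 htr => hall t ht0 (by omega) (by omega) (by omega))
        ((mem_bergmanFan_link hτ).1 hH.1).2 ((mem_bergmanFan_link hτ).1 hH'.1).2 hH.2 hH'.2 hne
      have hJS : J ∈ S := (hSmem J).2
        ⟨mem_link_of_rk_ne hτ hJ (by rwa [hJr, h]), hJr.trans h⟩
      rw [sum_eq_single_of_mem J hJS]
      · simp [ha, hGJ, hHJ]
      · intro K hK hKJ
        simp only [ha]
        split_ifs with h1 h2
        · rw [hSmem] at hK
          exact absurd (ProperFlat.eq_of_le_of_rk_le (hmin K h1 h2) (by omega)).symm hKJ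
        all_goals simp
  -- Otherwise a member of the flag has rank r + 1 and lies between every H in R and every K in S.
  -- The form is then twice the product of the sums over R and over S.
  · have ha1 : ∀ H ∈ R, ∀ K ∈ S, a H K = 1 := by
      intro H hH K hK
      rw [hRmem, mem_bergmanFan_link hτ] at hH
      rw [hSmem, mem_bergmanFan_link hτ] at hK
      obtain ⟨F, hF, hFr⟩ := hall (r + 1) (by omega) (by omega) (by omega) h
      exact if_pos ((ProperFlat.le_of_rk_lt (hH.1.2 F hF) (by omega)).trans
        (ProperFlat.le_of_rk_lt (hK.1.2 F hF).symm (by omega)))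
    simp only [if_neg h, mul_zero, sub_zero]
    rw [sum_congr (s₁ := (M.bergmanFan.link τ).filter fun H => ¬ H.rk = r) (g := fun _ => 0) rfl,
      sum_const_zero, add_zero, sum_congr (g := fun H => (∑ K ∈ S, z K) * z H) rfl, ← mul_sum]
    · exact (mul_eq_zero_of_right _ hz0).le
    · intro H hH
      rw [sum_congr rfl fun K hK => by rw [ha1 H hH K hK, one_mul]]
    · intro K hK
      rw [sum_congr rfl fun H hH => by rw [ha1 H hH K hK, one_mul], hz0, zero_mul]

/-- The reverse Cauchy–Schwarz inequality on the two-dimensional stars of the Bergman fan. -/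
lemma rayDeg_mul_le (hd : M.eRank = d + 1) (hτ : τ ∈ M.bergmanFan.faces)
    (hc : τ.card + 2 = d) (x y : M.ProperFlat → ℝ)
    (hy : 0 < M.bergmanFan.rayDeg (fun _ => 1) τ [y, y]) :
    M.bergmanFan.rayDeg (fun _ => 1) τ [x, x] * M.bergmanFan.rayDeg (fun _ => 1) τ [y, y] ≤
      M.bergmanFan.rayDeg (fun _ => 1) τ [x, y] ^ 2 := by
  have hX := isTropical_bergmanFan hd
  obtain ⟨R, hR⟩ := exists_rayDeg_nonpos hd hτ hc
  obtain ⟨B, hB, hBdef⟩ := MarkedCones.rayDeg_bilin hX.fan hX.balanced hτ (L := []) hc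
  -- Normalisation at τ, which leaves the degree form unchanged.
  let v : (M.ProperFlat → ℝ) → M.ProperFlat → ℝ := fun x F =>
    x F - M.bergmanFan.extend x τ (M.bergmanFan.mark F)
  have hv0 : ∀ x, ∀ F ∈ τ, v x F = 0 := fun x F hF => by
    simp [v, hX.fan.extend_mark hτ x hF]
  have hv : ∀ x y, B (v x) y = B x y := by
    intro x y
    rw [hBdef, hBdef]
    exact MarkedCones.rayDeg_congr_head hX.fan hX.balanced hτ (by simpa using hc)
      (l := -M.bergmanFan.extend x τ) (fun _ _ => sub_eq_add_neg _ _) (fun _ _ => sub_eq_add_neg _ _)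
  have hvv : ∀ x y, B (v x) (v y) = B x y := fun x y => by
    rw [hv, ← hB.eq (v y) x, hv]
    exact hB.eq y x
  simp only [← hBdef] at hy hR ⊢
  rw [← hvv x x, ← hvv y y, ← hvv x y]
  rw [← hvv y y] at hy
  -- The hyperplane is the kernel of the sum of the coordinates in R.
  refine hB.mul_le_sq (∑ F ∈ R, LinearMap.proj F) (fun s t h => hR _ (fun F hF => ?_) ?_) hy
  · simp [hv0 x F hF, hv0 y F hF]
  · simpa [LinearMap.sum_apply] using h

end Matroid

end

theorem mainTheorem5 {α : Type*} (M : Matroid α) [M.Finite] [M.Loopless] (d : ℕ)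
    (hd : M.eRank = d + 1) :
    M.bergmanFan.IsLorentzian d (fun _ => 1) :=
  (Matroid.isTropical_bergmanFan hd).isLorentzian (Matroid.separates_coordDiff hd)
    (fun _ hτ hc y hy => Matroid.bergmanFan_connected hd hτ hc y hy)
    (fun _ hτ hc x y hy => Matroid.rayDeg_mul_le hd hτ hc x y hy)
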